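/- Let $\mathcal H$ be a complex separable Hilbert space (inner product antilinear in the first argument) and let $T$ be a positive (i.e. positive semidefinite and self-adjoint), possibly unbounded operator on $\mathcal H$. Write $Q(T)=D(T^{1/2})$ and $\|\psi\|_T^2=\|\psi\|^2+\|T^{1/2}\psi\|^2$ for $\psi\in Q(T)$. For a positive operator $V$ and a positive trace class operator $\gamma$ put $\operatorname{Tr}(V\gamma):=\sup_{\varepsilon>0}\operatorname{Tr}\big(V(1+\varepsilon V)^{-1}\gamma\big)\in[0,\infty]$. Let $X^+$ be the set of positive trace class operators $\gamma$ on $\mathcal H$ with $\operatorname{Tr}(T\gamma)<\infty$, let $X=X^+-X^+$ (a real vector space), with the norm $$\|\gamma\|_X=\inf\{\operatorname{Tr}((1+T)\gamma^+)+\operatorname{Tr}((1+T)\gamma^-)\;:\;\gamma=\gamma^+-\gamma^-,\ \gamma^\pm \text{ positive trace class}\},$$ and let $X^*$ be the space of linear functionals $\omega:X\to\mathbb R$ with $|\omega(\gamma)|\le C\|\gamma\|_X$ for some $C>0$ and all $\gamma\in X$, with the norm $\|\omega\|_{X^*}=\sup_{0\ne\gamma\in X}|\omega(\gamma)|/\|\gamma\|_X$.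 For $\gamma=\gamma^+-\gamma^-$ with $\gamma^\pm\in X^+$, and a positive operator $V$ with $\operatorname{Tr}(V\gamma^\pm)<\infty$, put $\operatorname{Tr}(V\gamma):=\operatorname{Tr}(V\gamma^+)-\operatorname{Tr}(V\gamma^-)$. Let $\mathcal F(T)$ be the real vector space of Hermitian sesquilinear forms $v:Q(T)\times Q(T)\to\mathbb C$ such that $|v(\psi,\psi)|\le C\|\psi\|_T^2$ for some $C>0$ and all $\psi\in Q(T)$, with the norm $\|v\|_{\mathcal F(T)}=\sup_{0\ne\psi\in Q(T)}|v(\psi,\psi)|/\|\psi\|_T^2$. Then $|\psi\rangle\langle\psi|\in X$ for every $\psi\in Q(T)$, and there is a real-linear bijection $\Phi:X^*\to\mathcal F(T)$, $\omega\mapsto v_\omega$, such that: 1. $\|v_\omega\|_{\mathcal F(T)}=\|\omega\|_{X^*}$ for all $\omega\in X^*$. 2. $v_\omega(\psi,\varphi)=\frac14\sum_{k=0}^3 i^k\,\omega\big(|\psi+(-i)^k\varphi\rangle\langle\psi+(-i)^k\varphi|\big)$ for all $\psi,\varphi\in Q(T)$; in particular $v_\omega(\psi,\psi)=\omega(|\psi\rangle\langle\psi|)$.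 3. Let $v\in\mathcal F(T)$ and $\omega=\Phi^{-1}(v)$. For all sufficiently small $\lambda>0$ there are $a\in[0,1)$ and $b\ge0$ with $$|\lambda v(\psi,\psi)|\le a\|T^{1/2}\psi\|^2+b\|\psi\|^2\quad\text{for all }\psi\in Q(T).$$ For every $\lambda>0$ and all such $a,b$, there is a unique lower semibounded self-adjoint operator $C=T\dot+\lambda v$ whose associated sesquilinear form has domain $Q(T)$ and equals $\langle T^{1/2}\psi,T^{1/2}\varphi\rangle+\lambda v(\psi,\varphi)$; it satisfies $C\ge -b$; and for every real lower bound $\mu$ of $C$ and every $\gamma\in X$ (with any decomposition $\gamma=\gamma^+-\gamma^-$, $\gamma^\pm\in X^+$) one has $\operatorname{Tr}((C-\mu)\gamma^\pm)<\infty$ and $$\omega(\gamma)=\lambda^{-1}\big[\operatorname{Tr}((C-\mu)\gamma)-\operatorname{Tr}(T\gamma)+\mu\operatorname{Tr}(\gamma)\big].$$ -/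

import Mathlib

open ContinuousLinearMap in
/-- Criterion for self-adjointness of a densely defined operator: symmetric, and the domain of the
adjoint is not larger. -/
theorem LinearPMap.isSelfAdjoint_of_symmetric_of_maximal
    {H : Type*} [NormedAddCommGroup H] [InnerProductSpace ℂ H] [CompleteSpace H]
    (A : H →ₗ.[ℂ] H) (hd : Dense (A.domain : Set H))
    (hs : ∀ x y : A.domain, inner ℂ (A x) (y : H) = inner ℂ (x : H) (A y))
    (hm : ∀ y w : H, (∀ x : A.domain, inner ℂ w (x : H) = inner ℂ y (A x)) → y ∈ A.domain) :
    IsSelfAdjoint A := by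
  rw [LinearPMap.isSelfAdjoint_def]
  have h1 : A ≤ A.adjoint := LinearPMap.IsFormalAdjoint.le_adjoint hd
    (fun x y => hs x y)
  refine (LinearPMap.eq_of_le_of_domain_eq h1 ?_).symm
  refine le_antisymm h1.1 ?_
  intro y hy
  refine hm y (A.adjoint ⟨y, hy⟩) (fun x => ?_)
  exact LinearPMap.adjoint_isFormalAdjoint hd ⟨y, hy⟩ x

theorem LinearPMap.symmetric_of_isSelfAdjoint
    {H : Type*} [NormedAddCommGroup H] [InnerProductSpace ℂ H] [CompleteSpace H]
    {A : H →ₗ.[ℂ] H} (h : IsSelfAdjoint A) (x y : A.domain) :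
    inner ℂ (A x) (y : H) = inner ℂ (x : H) (A y) := by
  have := LinearPMap.adjoint_isFormalAdjoint h.dense_domain
  rw [LinearPMap.isSelfAdjoint_def.mp h] at this
  exact this x y

theorem LinearPMap.mem_domain_of_isSelfAdjoint
    {H : Type*} [NormedAddCommGroup H] [InnerProductSpace ℂ H] [CompleteSpace H]
    {A : H →ₗ.[ℂ] H} (h : IsSelfAdjoint A) (y w : H)
    (hw : ∀ x : A.domain, inner ℂ w (x : H) = inner ℂ y (A x)) :
    ∃ hy : y ∈ A.domain, A ⟨y, hy⟩ = w := by
  have hy : y ∈ A.adjoint.domain := LinearPMap.mem_adjoint_domain_of_exists y ⟨w, hw⟩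
  have hy' : y ∈ A.domain := by rwa [LinearPMap.isSelfAdjoint_def.mp h] at hy
  refine ⟨hy', ?_⟩
  refine h.dense_domain.eq_of_inner_left ℂ (fun v hv => ?_)
  rw [LinearPMap.symmetric_of_isSelfAdjoint h ⟨y, hy'⟩ ⟨v, hv⟩, hw ⟨v, hv⟩]

theorem LinearPMap.isSelfAdjoint_real_smul_vadd
    {H : Type*} [NormedAddCommGroup H] [InnerProductSpace ℂ H] [CompleteSpace H]
    {A : H →ₗ.[ℂ] H} (h : IsSelfAdjoint A) (c : ℝ) :
    IsSelfAdjoint (((c : ℂ) • (LinearMap.id : H →ₗ[ℂ] H)) +ᵥ A) := by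
  apply LinearPMap.isSelfAdjoint_of_symmetric_of_maximal
  · exact h.dense_domain
  · intro x y
    have := LinearPMap.symmetric_of_isSelfAdjoint h x y
    simp only [LinearPMap.vadd_apply, LinearMap.smul_apply, LinearMap.id_coe, id_eq,
      inner_add_left, inner_add_right, inner_smul_left, inner_smul_right, Complex.conj_ofReal]
    rw [← this]
  · intro y w hw
    refine (LinearPMap.mem_domain_of_isSelfAdjoint h y (w - (c : ℂ) • y) (fun x => ?_)).1
    have := hw x
    simp only [LinearPMap.vadd_apply, LinearMap.smul_apply, LinearMap.id_coe, id_eq,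
      inner_add_right, inner_smul_right] at this
    rw [inner_sub_left, this, inner_smul_left, Complex.conj_ofReal]
    ring_nf

/-- A positive (that is, positive semidefinite and self-adjoint), possibly unbounded operator. -/
structure PosOp (H : Type*) [NormedAddCommGroup H] [InnerProductSpace ℂ H] [CompleteSpace H] where
  toPMap : H →ₗ.[ℂ] H
  isSelfAdjoint : IsSelfAdjoint toPMap
  nonneg : ∀ ψ : toPMap.domain, 0 ≤ (inner ℂ (ψ : H) (toPMap ψ)).re

/-- `μ` is a lower bound of the operator `C`. -/
def IsLowerBound {H : Type*} [NormedAddCommGroup H] [InnerProductSpace ℂ H]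
    (C : H →ₗ.[ℂ] H) (μ : ℝ) : Prop :=
  ∀ ψ : C.domain, μ * ‖(ψ : H)‖ ^ 2 ≤ (inner ℂ (ψ : H) (C ψ)).re

namespace PosOp

section

variable {H : Type*} [NormedAddCommGroup H] [InnerProductSpace ℂ H] [CompleteSpace H]

/-- The positive operator `C - μ`, for a self-adjoint operator `C` with lower bound `μ`. -/
def subLowerBound (C : H →ₗ.[ℂ] H) (hC : IsSelfAdjoint C) (μ : ℝ) (hμ : IsLowerBound C μ) :
    PosOp H where
  toPMap := (((-μ : ℝ) : ℂ) • (LinearMap.id : H →ₗ[ℂ] H)) +ᵥ C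
  isSelfAdjoint := LinearPMap.isSelfAdjoint_real_smul_vadd hC (-μ)
  nonneg := fun ψ => by
    have h := hμ ψ
    have e : (inner ℂ (ψ : H) (ψ : H)).re = ‖(ψ : H)‖ ^ 2 := inner_self_eq_norm_sq (𝕜 := ℂ) _
    rw [LinearPMap.vadd_apply, LinearMap.smul_apply, LinearMap.id_apply,
      inner_add_right, inner_smul_right, Complex.add_re, Complex.re_ofReal_mul, e]
    linarith

/-- The positive operator `1 + T`. -/
def oneAdd (T : PosOp H) : PosOp H where
  toPMap := (((1 : ℝ) : ℂ) • (LinearMap.id : H →ₗ[ℂ] H)) +ᵥ T.toPMap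
  isSelfAdjoint := LinearPMap.isSelfAdjoint_real_smul_vadd T.isSelfAdjoint 1
  nonneg := fun ψ => by
    have h := T.nonneg ψ
    have e : (inner ℂ (ψ : H) (ψ : H)).re = ‖(ψ : H)‖ ^ 2 := inner_self_eq_norm_sq (𝕜 := ℂ) _
    rw [LinearPMap.vadd_apply, LinearMap.smul_apply, LinearMap.id_apply,
      inner_add_right, inner_smul_right, Complex.add_re, Complex.re_ofReal_mul, e, one_mul]
    exact add_nonneg (sq_nonneg _) h

variable (T : PosOp H)

theorem inner_self_im (x : T.toPMap.domain) : (inner ℂ (x : H) (T.toPMap x)).im = 0 := by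
  have h := LinearPMap.symmetric_of_isSelfAdjoint T.isSelfAdjoint x x
  rw [← inner_conj_symm] at h
  exact Complex.conj_eq_iff_im.mp h

theorem norm_sq_add_smul (ε : Set.Ioi (0 : ℝ)) (x : T.toPMap.domain) :
    ‖(x : H)‖ ^ 2 + ‖((ε : ℝ) : ℂ) • T.toPMap x‖ ^ 2 ≤
      ‖(x : H) + ((ε : ℝ) : ℂ) • T.toPMap x‖ ^ 2 := by
  rw [norm_add_sq (𝕜 := ℂ), inner_smul_right]
  have h1 := T.nonneg x
  have h2 : (0 : ℝ) < ε := ε.2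
  have h3 : 0 ≤ RCLike.re (((ε : ℝ) : ℂ) * inner ℂ (x : H) (T.toPMap x)) := by
    simp only [RCLike.re_to_complex, Complex.mul_re, Complex.ofReal_re, Complex.ofReal_im]
    simp only [zero_mul, sub_zero]
    positivity
  linarith

/-- The linear map `1 + εT` on the domain of `T`. -/
def oneAddSMul (ε : Set.Ioi (0 : ℝ)) : T.toPMap.domain →ₗ[ℂ] H :=
  T.toPMap.domain.subtype + ((ε : ℝ) : ℂ) • T.toPMap.toFun

theorem oneAddSMul_apply (ε : Set.Ioi (0 : ℝ)) (x : T.toPMap.domain) :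
    T.oneAddSMul ε x = (x : H) + ((ε : ℝ) : ℂ) • T.toPMap x := rfl

theorem norm_le_oneAddSMul (ε : Set.Ioi (0 : ℝ)) (x : T.toPMap.domain) :
    ‖(x : H)‖ ≤ ‖T.oneAddSMul ε x‖ := by
  have := T.norm_sq_add_smul ε x
  rw [oneAddSMul_apply]
  refine le_of_sq_le_sq (by nlinarith [sq_nonneg ‖((ε : ℝ) : ℂ) • T.toPMap x‖]) (norm_nonneg _)

theorem oneAddSMul_bijective (ε : Set.Ioi (0 : ℝ)) : Function.Bijective (T.oneAddSMul ε) := by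
  have hε : (0 : ℝ) < ε := ε.2
  have hε0 : ((ε : ℝ) : ℂ) ≠ 0 := by exact_mod_cast hε.ne'
  constructor
  · rw [injective_iff_map_eq_zero]
    intro x hx
    have := T.norm_le_oneAddSMul ε x
    rw [hx, norm_zero] at this
    exact Subtype.ext (norm_le_zero_iff.mp this)
  · rw [← LinearMap.range_eq_top]
    have hcl : IsClosed ((LinearMap.range (T.oneAddSMul ε) : Submodule ℂ H) : Set H) := by
      have hg : IsClosed (T.toPMap.graph : Set (H × H)) := T.isSelfAdjoint.isClosed
      let g : T.toPMap.graph → H := fun p => p.1.1 + ((ε : ℝ) : ℂ) • p.1.2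
      have hgc : UniformContinuous g := by
        have : UniformContinuous (fun p : H × H => p.1 + ((ε : ℝ) : ℂ) • p.2) :=
          uniformContinuous_fst.add (uniformContinuous_snd.const_smul _)
        exact this.comp uniformContinuous_subtype_val
      have hga : AntilipschitzWith (1 + ‖(((ε : ℝ) : ℂ))⁻¹‖₊) g := by
        refine AntilipschitzWith.of_le_mul_dist (fun p q => ?_)
        have key : ∀ r : T.toPMap.graph,
            ‖(r : H × H)‖ ≤ (1 + ‖(((ε : ℝ) : ℂ))⁻¹‖) * ‖r.1.1 + ((ε : ℝ) : ℂ) • r.1.2‖ := by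
          intro r
          obtain ⟨x, hx1, hx2⟩ := (LinearPMap.mem_graph_iff _).mp r.2
          have h0 := T.norm_sq_add_smul ε x
          rw [hx1, hx2] at h0
          have ha : ‖r.1.1‖ ≤ ‖r.1.1 + ((ε : ℝ) : ℂ) • r.1.2‖ :=
            le_of_sq_le_sq (by nlinarith [sq_nonneg ‖((ε : ℝ) : ℂ) • r.1.2‖]) (norm_nonneg _)
          have hb : ‖((ε : ℝ) : ℂ) • r.1.2‖ ≤ ‖r.1.1 + ((ε : ℝ) : ℂ) • r.1.2‖ :=
            le_of_sq_le_sq (by nlinarith [sq_nonneg ‖r.1.1‖]) (norm_nonneg _)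
          have hc : ‖r.1.2‖ = ‖(((ε : ℝ) : ℂ))⁻¹‖ * ‖((ε : ℝ) : ℂ) • r.1.2‖ := by
            rw [← norm_smul, smul_smul, inv_mul_cancel₀ hε0, one_smul]
          rw [Prod.norm_def]
          refine max_le ?_ ?_
          · nlinarith [norm_nonneg (((ε : ℝ) : ℂ))⁻¹,
              norm_nonneg (r.1.1 + ((ε : ℝ) : ℂ) • r.1.2)]
          · rw [hc]
            nlinarith [norm_nonneg (((ε : ℝ) : ℂ))⁻¹,
              norm_nonneg (r.1.1 + ((ε : ℝ) : ℂ) • r.1.2)]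
        have h1 := key (p - q)
        rw [dist_eq_norm, dist_eq_norm]
        have h2 : g p - g q = (p - q).1.1 + ((ε : ℝ) : ℂ) • (p - q).1.2 := by
          simp only [g, Submodule.coe_sub, Prod.fst_sub, Prod.snd_sub, smul_sub]
          abel
        rw [h2]
        exact h1
      have hcs : CompleteSpace T.toPMap.graph := hg.completeSpace_coe
      have := hga.isClosed_range hgc
      convert this using 1
      ext y
      constructor
      · rintro ⟨x, rfl⟩
        exact ⟨⟨_, T.toPMap.mem_graph x⟩, rfl⟩
      · rintro ⟨r, rfl⟩
        obtain ⟨x, hx1, hx2⟩ := (LinearPMap.mem_graph_iff _).mp r.2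
        exact ⟨x, by rw [oneAddSMul_apply, hx1, hx2]⟩
    have hcs : CompleteSpace (LinearMap.range (T.oneAddSMul ε) : Submodule ℂ H) :=
      hcl.completeSpace_coe
    rw [← Submodule.orthogonal_eq_bot_iff, Submodule.eq_bot_iff]
    intro y hy
    have hy' : ∀ x : T.toPMap.domain,
        inner ℂ y (x : H) + ((ε : ℝ) : ℂ) * inner ℂ y (T.toPMap x) = 0 := by
      intro x
      have := Submodule.inner_left_of_mem_orthogonal (LinearMap.mem_range_self (T.oneAddSMul ε) x) hy
      rwa [oneAddSMul_apply, inner_add_right, inner_smul_right] at this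
    obtain ⟨hyd, hTy⟩ := LinearPMap.mem_domain_of_isSelfAdjoint T.isSelfAdjoint y
      (-((((ε : ℝ) : ℂ))⁻¹ • y)) (fun x => by
        rw [inner_neg_left, inner_smul_left, map_inv₀, Complex.conj_ofReal]
        have := hy' x
        field_simp
        linear_combination -this)
    have h1 := hy' ⟨y, hyd⟩
    have h2 := T.nonneg ⟨y, hyd⟩
    have h3 := congrArg Complex.re h1
    simp only [Complex.add_re, Complex.mul_re, Complex.ofReal_re, Complex.ofReal_im, zero_mul,
      sub_zero, Complex.zero_re] at h3
    have h4 : (inner ℂ y y : ℂ).re = ‖y‖ ^ 2 := by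
      rw [inner_self_eq_norm_sq_to_K]; norm_cast
    rw [h4] at h3
    have : ‖y‖ ^ 2 ≤ 0 := by
      have : 0 ≤ (ε : ℝ) * (inner ℂ y (T.toPMap ⟨y, hyd⟩)).re := mul_nonneg hε.le h2
      linarith
    exact norm_eq_zero.mp (pow_eq_zero_iff (two_ne_zero) |>.mp (le_antisymm this (sq_nonneg _)))

/-- The bounded operator `(1 + εT)⁻¹`, for `ε > 0`. -/
noncomputable def resolvent (ε : Set.Ioi (0 : ℝ)) : H →L[ℂ] H :=
  (T.toPMap.domain.subtype ∘ₗ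
    (LinearEquiv.ofBijective (T.oneAddSMul ε) (T.oneAddSMul_bijective ε)).symm.toLinearMap
      ).mkContinuous 1 (fun y => by
    have := T.norm_le_oneAddSMul ε
      ((LinearEquiv.ofBijective (T.oneAddSMul ε) (T.oneAddSMul_bijective ε)).symm y)
    rw [one_mul]
    refine this.trans (le_of_eq ?_)
    congr 1
    exact (LinearEquiv.ofBijective (T.oneAddSMul ε) (T.oneAddSMul_bijective ε)).apply_symm_apply y)

theorem resolvent_mem (ε : Set.Ioi (0 : ℝ)) (y : H) : T.resolvent ε y ∈ T.toPMap.domain :=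
  Subtype.property _

theorem resolvent_right (ε : Set.Ioi (0 : ℝ)) (y : H) :
    T.resolvent ε y + ((ε : ℝ) : ℂ) • T.toPMap ⟨T.resolvent ε y, T.resolvent_mem ε y⟩ = y :=
  (LinearEquiv.ofBijective (T.oneAddSMul ε) (T.oneAddSMul_bijective ε)).apply_symm_apply y

theorem resolvent_left (ε : Set.Ioi (0 : ℝ)) (x : T.toPMap.domain) :
    T.resolvent ε ((x : H) + ((ε : ℝ) : ℂ) • T.toPMap x) = x :=
  congrArg Subtype.val
    ((LinearEquiv.ofBijective (T.oneAddSMul ε) (T.oneAddSMul_bijective ε)).symm_apply_apply x)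

theorem toPMap_congr {x y : T.toPMap.domain} (h : (x : H) = y) : T.toPMap x = T.toPMap y := by
  rw [Subtype.ext h]

theorem inner_resolvent (ε : Set.Ioi (0 : ℝ)) (y z : H) :
    inner ℂ (T.resolvent ε y) z = inner ℂ y (T.resolvent ε z) := by
  have hy := T.resolvent_right ε y
  have hz := T.resolvent_right ε z
  have hs := LinearPMap.symmetric_of_isSelfAdjoint T.isSelfAdjoint
    ⟨_, T.resolvent_mem ε y⟩ ⟨_, T.resolvent_mem ε z⟩
  conv_lhs => rw [← hz]
  conv_rhs => rw [← hy]
  rw [inner_add_left, inner_add_right, inner_smul_left, inner_smul_right, Complex.conj_ofReal, hs]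

theorem resolvent_nonneg (ε : Set.Ioi (0 : ℝ)) : 0 ≤ T.resolvent ε := by
  rw [ContinuousLinearMap.nonneg_iff_isPositive]
  refine ⟨fun y z => T.inner_resolvent ε y z, fun y => ?_⟩
  have hy := T.resolvent_right ε y
  have h1 := T.nonneg ⟨_, T.resolvent_mem ε y⟩
  have h2 : (0 : ℝ) < ε := ε.2
  rw [ContinuousLinearMap.reApplyInnerSelf_apply]
  change 0 ≤ (inner ℂ (T.resolvent ε y) y).re
  set x : T.toPMap.domain := ⟨_, T.resolvent_mem ε y⟩ with hx
  have h4 : y = (x : H) + ((ε : ℝ) : ℂ) • T.toPMap x := hy.symm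
  have h5 : T.resolvent ε y = (x : H) := rfl
  have e : (inner ℂ (x : H) (x : H)).re = ‖(x : H)‖ ^ 2 := inner_self_eq_norm_sq (𝕜 := ℂ) _
  rw [h5, h4, inner_add_right, inner_smul_right, Complex.add_re, Complex.re_ofReal_mul, e]
  exact add_nonneg (sq_nonneg _) (mul_nonneg h2.le h1)

theorem resolvent_le_one (ε : Set.Ioi (0 : ℝ)) : T.resolvent ε ≤ 1 := by
  rw [ContinuousLinearMap.le_def]
  refine ⟨fun y z => ?_, fun y => ?_⟩
  · have h := T.inner_resolvent ε y z
    simp only [ContinuousLinearMap.coe_coe, sub_apply,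
      one_apply_eq_self, inner_sub_left, inner_sub_right, h]
  · have hy := T.resolvent_right ε y
    have h1 := T.nonneg ⟨_, T.resolvent_mem ε y⟩
    have h2 : (0 : ℝ) < ε := ε.2
    have hR := (ContinuousLinearMap.nonneg_iff_isPositive _).mp (T.resolvent_nonneg ε)
    rw [ContinuousLinearMap.reApplyInnerSelf_apply]
    set x : T.toPMap.domain := ⟨_, T.resolvent_mem ε y⟩ with hx
    have h3 : ((1 : H →L[ℂ] H) - T.resolvent ε) y = ((ε : ℝ) : ℂ) • T.toPMap x := by
      rw [sub_apply, one_apply_eq_self, sub_eq_iff_eq_add']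
      exact hy.symm
    rw [h3]
    have h4 : y = (x : H) + ((ε : ℝ) : ℂ) • T.toPMap x := hy.symm
    have e : (inner ℂ (((ε : ℝ) : ℂ) • T.toPMap x) (((ε : ℝ) : ℂ) • T.toPMap x)).re =
      ‖((ε : ℝ) : ℂ) • T.toPMap x‖ ^ 2 := inner_self_eq_norm_sq (𝕜 := ℂ) _
    have h5 : (inner ℂ (T.toPMap x) (x : H)).re = (inner ℂ (x : H) (T.toPMap x)).re := by
      rw [← inner_conj_symm, Complex.conj_re]
    change 0 ≤ (inner ℂ (((ε : ℝ) : ℂ) • T.toPMap x) y).re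
    rw [h4, inner_add_right, Complex.add_re, e, inner_smul_left, Complex.conj_ofReal,
      Complex.re_ofReal_mul, h5]
    exact add_nonneg (mul_nonneg h2.le h1) (sq_nonneg _)

/-- The bounded operator `T(1 + εT)⁻¹`, for `ε > 0`; it equals `ε⁻¹(1 - (1 + εT)⁻¹)`, and is
introduced in this form because its boundedness is then evident. -/
noncomputable def yosida (ε : Set.Ioi (0 : ℝ)) : H →L[ℂ] H :=
  (((ε : ℝ) : ℂ))⁻¹ • (1 - T.resolvent ε)

theorem yosida_apply (ε : Set.Ioi (0 : ℝ)) (y : H) :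
    T.yosida ε y = T.toPMap ⟨T.resolvent ε y, T.resolvent_mem ε y⟩ := by
  have h2 : (0 : ℝ) < ε := ε.2
  have hε0 : ((ε : ℝ) : ℂ) ≠ 0 := by exact_mod_cast h2.ne'
  have h := T.resolvent_right ε y
  rw [yosida, smul_apply, sub_apply,
    one_apply_eq_self]
  nth_rewrite 1 [← h]
  rw [add_sub_cancel_left, smul_smul, inv_mul_cancel₀ hε0, one_smul]

/-- The bounded operator `R = (1 + T)⁻¹`. -/
noncomputable def res : H →L[ℂ] H := T.resolvent ⟨1, Set.mem_Ioi.mpr one_pos⟩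

theorem res_nonneg : 0 ≤ T.res := T.resolvent_nonneg _

theorem one_sub_res_nonneg : 0 ≤ 1 - T.res := sub_nonneg.mpr (T.resolvent_le_one _)

/-- The operator `√R` for `R = (1 + T)⁻¹`, that is, `(1 + T)^(-1/2)`. -/
noncomputable def sqrtRes : H →L[ℂ] H := CFC.sqrt T.res

/-- The operator `√(1 - R)` for `R = (1 + T)⁻¹`, that is, `T^(1/2) (1 + T)^(-1/2)`. -/
noncomputable def sqrtOneSubRes : H →L[ℂ] H := CFC.sqrt (1 - T.res)

theorem sqrtRes_sqrtRes (x : H) : T.sqrtRes (T.sqrtRes x) = T.res x := by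
  have := CFC.sqrt_mul_sqrt_self T.res T.res_nonneg
  exact congrArg (fun f : H →L[ℂ] H => f x) this

theorem sqrtOneSubRes_sqrtOneSubRes (x : H) :
    T.sqrtOneSubRes (T.sqrtOneSubRes x) = x - T.res x := by
  have := CFC.sqrt_mul_sqrt_self (1 - T.res) T.one_sub_res_nonneg
  exact congrArg (fun f : H →L[ℂ] H => f x) this

theorem inner_sqrtRes (x y : H) : inner ℂ (T.sqrtRes x) y = inner ℂ x (T.sqrtRes y) :=
  ((ContinuousLinearMap.nonneg_iff_isPositive _).mp (CFC.sqrt_nonneg T.res)).1 x y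

theorem inner_sqrtOneSubRes (x y : H) :
    inner ℂ (T.sqrtOneSubRes x) y = inner ℂ x (T.sqrtOneSubRes y) :=
  ((ContinuousLinearMap.nonneg_iff_isPositive _).mp (CFC.sqrt_nonneg (1 - T.res))).1 x y

theorem sqrt_commute : Commute T.sqrtRes T.sqrtOneSubRes := by
  have h1 : Commute T.res (1 - T.res) := (Commute.one_right _).sub_right (Commute.refl _)
  have h2 : Commute T.sqrtRes (1 - T.res) := (h1.cfcₙ_nnreal NNReal.sqrt)
  exact (h2.symm.cfcₙ_nnreal NNReal.sqrt).symm

theorem sqrt_comm (x : H) :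
    T.sqrtRes (T.sqrtOneSubRes x) = T.sqrtOneSubRes (T.sqrtRes x) :=
  congrArg (fun f : H →L[ℂ] H => f x) T.sqrt_commute

theorem res_left (x : T.toPMap.domain) : T.res ((x : H) + T.toPMap x) = x := by
  have := T.resolvent_left ⟨1, Set.mem_Ioi.mpr one_pos⟩ x
  simp only [Complex.ofReal_one, one_smul] at this
  exact this

theorem res_right (y : H) :
    T.toPMap ⟨T.res y, T.resolvent_mem _ y⟩ = y - T.res y := by
  have := T.resolvent_right ⟨1, Set.mem_Ioi.mpr one_pos⟩ y
  simp only [Complex.ofReal_one, one_smul] at this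
  exact eq_sub_of_add_eq' this

theorem sqrtRes_injective : Function.Injective T.sqrtRes := by
  rw [injective_iff_map_eq_zero]
  intro x hx
  have h : T.res x = 0 := by rw [← sqrtRes_sqrtRes, hx, map_zero]
  have h2 := T.res_right x
  have h3 : T.toPMap ⟨T.res x, T.resolvent_mem _ x⟩ = T.toPMap 0 := T.toPMap_congr (by simpa using h)
  rw [h3, h, LinearPMap.map_zero, sub_zero] at h2
  exact h2.symm

/-- The square root `T^(1/2)` of a positive operator, as an unbounded operator, through the
functional calculus of the bounded operator `R = (1 + T)⁻¹`: its domain is the range of `√R`, and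
`T^(1/2) (√R x) = √(1 - R) x`. -/
noncomputable def sqrtPMap : H →ₗ.[ℂ] H where
  domain := LinearMap.range T.sqrtRes.toLinearMap
  toFun := T.sqrtOneSubRes.toLinearMap ∘ₗ
    (LinearEquiv.ofInjective T.sqrtRes.toLinearMap T.sqrtRes_injective).symm.toLinearMap

theorem sqrtRes_mem (x : H) : T.sqrtRes x ∈ T.sqrtPMap.domain :=
  LinearMap.mem_range_self T.sqrtRes.toLinearMap x

theorem sqrtPMap_apply (x : H) (h : T.sqrtRes x ∈ T.sqrtPMap.domain) :
    T.sqrtPMap ⟨T.sqrtRes x, h⟩ = T.sqrtOneSubRes x :=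
  congrArg T.sqrtOneSubRes
    ((LinearEquiv.ofInjective T.sqrtRes.toLinearMap T.sqrtRes_injective).symm_apply_apply x)

/-- The positive operator `T^(1/2)`. -/
noncomputable def sqrt : PosOp H where
  toPMap := T.sqrtPMap
  isSelfAdjoint := by
    apply LinearPMap.isSelfAdjoint_of_symmetric_of_maximal
    · refine T.isSelfAdjoint.dense_domain.mono (fun x hx => ?_)
      have h := T.res_left ⟨x, hx⟩
      rw [← sqrtRes_sqrtRes] at h
      exact ⟨_, h⟩
    · rintro ⟨_, x, rfl⟩ ⟨_, y, rfl⟩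
      change inner ℂ (T.sqrtPMap ⟨T.sqrtRes x, T.sqrtRes_mem x⟩) (T.sqrtRes y) =
        inner ℂ (T.sqrtRes x) (T.sqrtPMap ⟨T.sqrtRes y, T.sqrtRes_mem y⟩)
      rw [sqrtPMap_apply, sqrtPMap_apply, inner_sqrtOneSubRes, inner_sqrtRes, sqrt_comm]
    · intro y w hw
      have h1 : T.sqrtRes w = T.sqrtOneSubRes y := by
        refine ext_inner_right ℂ (fun x => ?_)
        rw [inner_sqrtRes, inner_sqrtOneSubRes]
        have := hw ⟨_, T.sqrtRes_mem x⟩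
        rwa [sqrtPMap_apply] at this
      have h2 : y = T.sqrtRes (T.sqrtRes y + T.sqrtOneSubRes w) := by
        rw [map_add, sqrtRes_sqrtRes, sqrt_comm, h1, sqrtOneSubRes_sqrtOneSubRes]
        abel
      rw [h2]
      exact T.sqrtRes_mem _
  nonneg := by
    rintro ⟨_, x, rfl⟩
    change 0 ≤ (inner ℂ (T.sqrtRes x) (T.sqrtPMap ⟨T.sqrtRes x, T.sqrtRes_mem x⟩)).re
    rw [sqrtPMap_apply]
    have h := T.sqrt_commute.mul_nonneg (CFC.sqrt_nonneg T.res) (CFC.sqrt_nonneg (1 - T.res))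
    have h2 := ((ContinuousLinearMap.nonneg_iff_isPositive _).mp h).re_inner_nonneg_right x
    rw [inner_sqrtRes]
    exact h2

/-- `T^(1/2)` is the positive square root of `T`: a vector is in the domain of `T` exactly if
`T^(1/2)` can be applied to it twice, and then the result is the value of `T`. -/
theorem sqrt_sqrt (x y : H) :
    (∃ hx : x ∈ T.toPMap.domain, T.toPMap ⟨x, hx⟩ = y) ↔
      ∃ (h : x ∈ T.sqrt.toPMap.domain) (h2 : T.sqrt.toPMap ⟨x, h⟩ ∈ T.sqrt.toPMap.domain),
        T.sqrt.toPMap ⟨T.sqrt.toPMap ⟨x, h⟩, h2⟩ = y := by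
  change _ ↔ ∃ (h : x ∈ T.sqrtPMap.domain) (h2 : T.sqrtPMap ⟨x, h⟩ ∈ T.sqrtPMap.domain),
        T.sqrtPMap ⟨T.sqrtPMap ⟨x, h⟩, h2⟩ = y
  constructor
  · rintro ⟨hx, rfl⟩
    obtain ⟨z, rfl⟩ : ∃ z, T.res z = x := ⟨_, T.res_left ⟨x, hx⟩⟩
    have e1 : T.res z = T.sqrtRes (T.sqrtRes z) := (T.sqrtRes_sqrtRes z).symm
    have m1 : T.res z ∈ T.sqrtPMap.domain := by rw [e1]; exact T.sqrtRes_mem _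
    have e2 : T.sqrtPMap ⟨T.res z, m1⟩ = T.sqrtRes (T.sqrtOneSubRes z) := by
      rw [sqrt_comm, ← T.sqrtPMap_apply (T.sqrtRes z) (T.sqrtRes_mem _)]
      congr 1
      exact Subtype.ext e1
    have m2 : T.sqrtPMap ⟨T.res z, m1⟩ ∈ T.sqrtPMap.domain := by rw [e2]; exact T.sqrtRes_mem _
    refine ⟨m1, m2, ?_⟩
    rw [T.res_right z, ← sqrtOneSubRes_sqrtOneSubRes,
      ← T.sqrtPMap_apply (T.sqrtOneSubRes z) (T.sqrtRes_mem _)]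
    congr 1
    exact Subtype.ext e2
  · rintro ⟨⟨z, rfl⟩, ⟨w, hw⟩, rfl⟩
    have e1 : T.sqrtPMap ⟨T.sqrtRes z, T.sqrtRes_mem z⟩ = T.sqrtOneSubRes z := T.sqrtPMap_apply z _
    have hw2 : T.sqrtRes w = T.sqrtOneSubRes z := hw.trans e1
    have hz : z = T.sqrtRes (T.sqrtRes z + T.sqrtOneSubRes w) := by
      rw [map_add, sqrtRes_sqrtRes, sqrt_comm, hw2, sqrtOneSubRes_sqrtOneSubRes]
      abel
    have hz2 : T.sqrtRes z = T.res (T.sqrtRes z + T.sqrtOneSubRes w) := by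
      conv_lhs => rw [hz]
      rw [sqrtRes_sqrtRes]
    have m : T.sqrtRes z ∈ T.toPMap.domain := by rw [hz2]; exact T.resolvent_mem _ _
    refine ⟨m, ?_⟩
    have e3 : T.toPMap ⟨T.sqrtRes z, m⟩ = T.sqrtOneSubRes w := by
      rw [T.toPMap_congr (y := ⟨_, T.resolvent_mem _ (T.sqrtRes z + T.sqrtOneSubRes w)⟩) hz2]
      refine (T.res_right _).trans ?_
      rw [← hz2]
      abel
    refine e3.trans ?_
    rw [← T.sqrtPMap_apply w (T.sqrtRes_mem w)]
    congr 1
    exact Subtype.ext hw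

end

end PosOp

/-! ### Trace class operators -/

section

variable {H : Type*} [NormedAddCommGroup H] [InnerProductSpace ℂ H] [CompleteSpace H]

variable (H) in
/-- The vectors of a fixed orthonormal basis of `H`. -/
noncomputable def onbSet : Set H := (exists_hilbertBasis ℂ H).choose

variable (H) in
/-- A fixed orthonormal basis of `H`; the traces below do not depend on it. -/
noncomputable def onb : HilbertBasis (onbSet H) ℂ H :=
  (exists_hilbertBasis ℂ H).choose_spec.choose

/-- `A` is trace class: `Tr |A| < ∞`, where `|A| = (A* A)^(1/2)`. -/
def IsTraceClass (A : H →L[ℂ] H) : Prop :=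
  Summable fun i => (inner ℂ (onb H i) (CFC.abs A (onb H i))).re

/-- The trace of a (trace class) operator. -/
noncomputable def opTrace (A : H →L[ℂ] H) : ℂ :=
  ∑' i, inner ℂ (onb H i) (A (onb H i))

variable (H) in
/-- The positive trace class operators. -/
def positiveTraceClass : Set (H →L[ℂ] H) := {γ | 0 ≤ γ ∧ IsTraceClass γ}

theorem isTraceClass_iff_of_nonneg {γ : H →L[ℂ] H} (h : 0 ≤ γ) :
    IsTraceClass γ ↔ Summable fun i => (inner ℂ (onb H i) (γ (onb H i))).re := by
  rw [IsTraceClass, CFC.abs_of_nonneg γ h]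

theorem hasSum_onb_sq (x : H) : HasSum (fun i => ‖inner ℂ (onb H i) x‖ ^ 2) (‖x‖ ^ 2) := by
  have h := Complex.hasSum_re ((onb H).hasSum_inner_mul_inner x x)
  convert h using 1
  · funext i
    rw [← inner_conj_symm x, ← Complex.normSq_eq_conj_mul_self, Complex.ofReal_re,
      Complex.normSq_eq_norm_sq]
  · exact (inner_self_eq_norm_sq (𝕜 := ℂ) x).symm

theorem summable_adjoint_sq (A : H →L[ℂ] H) (h : Summable fun i => ‖A (onb H i)‖ ^ 2) :
    Summable fun i => ‖A.adjoint (onb H i)‖ ^ 2 := by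
  have h1 : Summable fun p : onbSet H × onbSet H =>
      ‖inner ℂ (onb H p.2) (A (onb H p.1))‖ ^ 2 := by
    refine (summable_prod_of_nonneg (fun _ => sq_nonneg _)).mpr
      ⟨fun i => (hasSum_onb_sq (A (onb H i))).summable, ?_⟩
    exact h.congr (fun i => (hasSum_onb_sq (A (onb H i))).tsum_eq.symm)
  have h2 := ((summable_prod_of_nonneg (fun _ => sq_nonneg _)).mp h1.prod_symm).2
  refine h2.congr (fun i => ?_)
  rw [← (hasSum_onb_sq (A.adjoint (onb H i))).tsum_eq]
  refine tsum_congr (fun j => ?_)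
  rw [ContinuousLinearMap.adjoint_inner_right, ← inner_conj_symm, RCLike.norm_conj]
  rfl

/-- The series defining the trace of `B γ` converges absolutely. -/
theorem summable_trace_mul (B : H →L[ℂ] H) {γ : H →L[ℂ] H} (hγ : γ ∈ positiveTraceClass H) :
    Summable fun i => inner ℂ (onb H i) ((B * γ) (onb H i)) := by
  have hs := (isTraceClass_iff_of_nonneg hγ.1).mp hγ.2
  set s := CFC.sqrt γ with hsd
  have hss : ∀ x, s (s x) = γ x := fun x =>
    congrArg (fun f : H →L[ℂ] H => f x) (CFC.sqrt_mul_sqrt_self γ hγ.1)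
  have hsa : ∀ x y, inner ℂ (s x) y = inner ℂ x (s y) :=
    ((ContinuousLinearMap.nonneg_iff_isPositive _).mp (CFC.sqrt_nonneg γ)).1
  have h1 : Summable fun i => ‖s (onb H i)‖ ^ 2 := by
    refine hs.congr (fun i => ?_)
    rw [← hss, ← hsa]
    exact inner_self_eq_norm_sq (𝕜 := ℂ) _
  have h2 : Summable fun i => ‖(B * s) (onb H i)‖ ^ 2 := by
    refine Summable.of_nonneg_of_le (fun _ => by positivity) (fun i => ?_) (h1.mul_left (‖B‖ ^ 2))
    rw [← mul_pow]
    gcongr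
    exact B.le_opNorm _
  have h3 := summable_adjoint_sq _ h2
  refine Summable.of_norm_bounded (h3.add h1) (fun i => ?_)
  have e : inner ℂ (onb H i) ((B * γ) (onb H i)) =
      inner ℂ ((B * s).adjoint (onb H i)) (s (onb H i)) := by
    rw [ContinuousLinearMap.adjoint_inner_left]
    change inner ℂ _ (B (γ _)) = inner ℂ _ (B (s (s _)))
    rw [hss]
  rw [e]
  refine (norm_inner_le_norm _ _).trans ?_
  nlinarith [sq_nonneg (‖(B * s).adjoint (onb H i)‖ - ‖s (onb H i)‖),
    sq_nonneg (‖(B * s).adjoint (onb H i)‖), sq_nonneg ‖s (onb H i)‖]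

theorem positiveTraceClass_zero : (0 : H →L[ℂ] H) ∈ positiveTraceClass H :=
  ⟨le_rfl, (isTraceClass_iff_of_nonneg le_rfl).mpr (by simp)⟩

theorem positiveTraceClass_add {γ δ : H →L[ℂ] H} (hγ : γ ∈ positiveTraceClass H)
    (hδ : δ ∈ positiveTraceClass H) : γ + δ ∈ positiveTraceClass H := by
  have h : 0 ≤ γ + δ := add_nonneg hγ.1 hδ.1
  refine ⟨h, (isTraceClass_iff_of_nonneg h).mpr ?_⟩
  refine (((isTraceClass_iff_of_nonneg hγ.1).mp hγ.2).add
    ((isTraceClass_iff_of_nonneg hδ.1).mp hδ.2)).congr (fun i => ?_)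
  rw [add_apply, inner_add_right, Complex.add_re]

theorem positiveTraceClass_smul {γ : H →L[ℂ] H} (hγ : γ ∈ positiveTraceClass H)
    {c : ℝ} (hc : 0 ≤ c) : c • γ ∈ positiveTraceClass H := by
  have h : 0 ≤ c • γ := smul_nonneg hc hγ.1
  refine ⟨h, (isTraceClass_iff_of_nonneg h).mpr ?_⟩
  refine (((isTraceClass_iff_of_nonneg hγ.1).mp hγ.2).mul_left c).congr (fun i => ?_)
  rw [smul_apply, ← Complex.coe_smul, inner_smul_right, Complex.re_ofReal_mul]

end

namespace PosOp

section

variable {H : Type*} [NormedAddCommGroup H] [InnerProductSpace ℂ H] [CompleteSpace H]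
variable (T : PosOp H)

/-- `Tr(Tγ) = sup_{ε > 0} Tr(T(1 + εT)⁻¹ γ)`, in `[0, ∞]`, for positive trace class `γ`. -/
noncomputable def traceMul (γ : H →L[ℂ] H) : ENNReal :=
  ⨆ ε : Set.Ioi (0 : ℝ), ENNReal.ofReal (opTrace (T.yosida ε * γ)).re

/-- The cone `X⁺` of positive trace class operators `γ` with `Tr(Tγ) < ∞`. -/
def XPlus : Set (H →L[ℂ] H) := {γ | γ ∈ positiveTraceClass H ∧ T.traceMul γ < ⊤}

theorem XPlus_zero : (0 : H →L[ℂ] H) ∈ T.XPlus := by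
  refine ⟨positiveTraceClass_zero, ?_⟩
  simp [traceMul, opTrace]

theorem XPlus_add {γ δ : H →L[ℂ] H} (hγ : γ ∈ T.XPlus) (hδ : δ ∈ T.XPlus) : γ + δ ∈ T.XPlus := by
  refine ⟨positiveTraceClass_add hγ.1 hδ.1, ?_⟩
  refine lt_of_le_of_lt (iSup_le (fun ε => ?_)) (ENNReal.add_lt_top.mpr ⟨hγ.2, hδ.2⟩)
  have e : opTrace (T.yosida ε * (γ + δ)) =
      opTrace (T.yosida ε * γ) + opTrace (T.yosida ε * δ) := by
    rw [opTrace, opTrace, opTrace, ← (summable_trace_mul _ hγ.1).tsum_add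
      (summable_trace_mul _ hδ.1)]
    refine tsum_congr (fun i => ?_)
    rw [mul_add, add_apply, inner_add_right]
  rw [e, Complex.add_re]
  refine ENNReal.ofReal_add_le.trans (add_le_add ?_ ?_)
  · exact le_iSup (fun ε => ENNReal.ofReal (opTrace (T.yosida ε * γ)).re) ε
  · exact le_iSup (fun ε => ENNReal.ofReal (opTrace (T.yosida ε * δ)).re) ε

theorem XPlus_smul {γ : H →L[ℂ] H} (hγ : γ ∈ T.XPlus) {c : ℝ} (hc : 0 ≤ c) :
    c • γ ∈ T.XPlus := by
  refine ⟨positiveTraceClass_smul hγ.1 hc, ?_⟩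
  refine lt_of_le_of_lt (iSup_le (fun ε => ?_))
    (ENNReal.mul_lt_top (ENNReal.ofReal_lt_top (r := c)) hγ.2)
  have e : opTrace (T.yosida ε * (c • γ)) = (c : ℂ) * opTrace (T.yosida ε * γ) := by
    rw [opTrace, opTrace, ← tsum_mul_left]
    refine tsum_congr (fun i => ?_)
    rw [mul_smul_comm, smul_apply, ← Complex.coe_smul, inner_smul_right]
  rw [e, Complex.re_ofReal_mul, ENNReal.ofReal_mul hc]
  gcongr
  exact le_iSup (fun ε => ENNReal.ofReal (opTrace (T.yosida ε * γ)).re) ε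

/-- The real vector space `X = X⁺ - X⁺`. -/
def X : Submodule ℝ (H →L[ℂ] H) where
  carrier := {γ | ∃ γp ∈ T.XPlus, ∃ γm ∈ T.XPlus, γ = γp - γm}
  add_mem' := by
    rintro _ _ ⟨a, ha, b, hb, rfl⟩ ⟨c, hc, d, hd, rfl⟩
    exact ⟨a + c, T.XPlus_add ha hc, b + d, T.XPlus_add hb hd, by abel⟩
  zero_mem' := ⟨0, T.XPlus_zero, 0, T.XPlus_zero, by simp⟩
  smul_mem' := by
    rintro c _ ⟨a, ha, b, hb, rfl⟩
    rcases le_total 0 c with hc | hc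
    · exact ⟨c • a, T.XPlus_smul ha hc, c • b, T.XPlus_smul hb hc, smul_sub c a b⟩
    · refine ⟨(-c) • b, T.XPlus_smul hb (neg_nonneg.mpr hc),
        (-c) • a, T.XPlus_smul ha (neg_nonneg.mpr hc), ?_⟩
      rw [smul_sub, neg_smul, neg_smul]
      abel

/-- The norm of `X` as an extended real: the infimum of `Tr((1 + T)γ⁺) + Tr((1 + T)γ⁻)` over all
decompositions `γ = γ⁺ - γ⁻` into positive trace class operators. -/
noncomputable def extNormX (γ : H →L[ℂ] H) : ENNReal :=
  ⨅ (γp ∈ positiveTraceClass H) (γm ∈ positiveTraceClass H) (_ : γ = γp - γm),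
    T.oneAdd.traceMul γp + T.oneAdd.traceMul γm

/-- The norm of `X`. -/
noncomputable def normX (γ : T.X) : ℝ := (T.extNormX (γ : H →L[ℂ] H)).toReal

theorem normX_nonneg (γ : T.X) : 0 ≤ T.normX γ := ENNReal.toReal_nonneg

/-- The dual space `X*`: the linear functionals on `X` that are bounded with respect to the norm
of `X`. -/
def dualX : Submodule ℝ (T.X →ₗ[ℝ] ℝ) where
  carrier := {ω | ∃ C > 0, ∀ γ, |ω γ| ≤ C * T.normX γ}
  add_mem' := by
    rintro ω η ⟨C, hC, h⟩ ⟨D, hD, k⟩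
    refine ⟨C + D, add_pos hC hD, fun γ => ?_⟩
    rw [LinearMap.add_apply, add_mul]
    exact (abs_add_le _ _).trans (add_le_add (h γ) (k γ))
  zero_mem' := ⟨1, one_pos, fun γ => by simpa using T.normX_nonneg γ⟩
  smul_mem' := by
    rintro c ω ⟨C, hC, h⟩
    refine ⟨(|c| + 1) * C, by positivity, fun γ => ?_⟩
    rw [LinearMap.smul_apply, smul_eq_mul, abs_mul, mul_assoc]
    refine mul_le_mul (by linarith) (h γ) (abs_nonneg _) (by positivity)

/-- The norm of `X*`: the supremum of `|ω(γ)| / ‖γ‖_X`. (The quotient is `0` at `γ = 0`.) -/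
noncomputable def normDual (ω : T.X →ₗ[ℝ] ℝ) : ℝ := ⨆ γ : T.X, |ω γ| / T.normX γ

/-! ### Sesquilinear forms on the form domain -/

/-- The form domain `Q(T)`, the domain of `T^(1/2)`. -/
noncomputable def formDomain : Submodule ℂ H := T.sqrt.toPMap.domain

/-- The sesquilinear form `t` associated with `T`: `t(ψ, φ) = ⟨T^(1/2) ψ, T^(1/2) φ⟩`. -/
noncomputable def form (ψ φ : T.formDomain) : ℂ :=
  inner ℂ (T.sqrt.toPMap ψ) (T.sqrt.toPMap φ)

/-- `‖ψ‖_T² = ‖ψ‖² + ‖T^(1/2) ψ‖²`. -/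
noncomputable def normSqT (ψ : T.formDomain) : ℝ := ‖(ψ : H)‖ ^ 2 + ‖T.sqrt.toPMap ψ‖ ^ 2

theorem normSqT_nonneg (ψ : T.formDomain) : 0 ≤ T.normSqT ψ := by
  unfold normSqT; positivity

/-- Sesquilinear forms on `Q(T)`, antilinear in the first argument and linear in the second. -/
abbrev SesqForm : Type _ := T.formDomain →ₗ⋆[ℂ] T.formDomain →ₗ[ℂ] ℂ

/-- The space `F(T)` of Hermitian sesquilinear forms `v` on `Q(T)` for which there is `C > 0` with
`|v(ψ, ψ)| ≤ C ‖ψ‖_T²`. -/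
def formSpace : Submodule ℝ T.SesqForm where
  carrier := {v | (∀ ψ φ, v ψ φ = starRingEnd ℂ (v φ ψ)) ∧
    ∃ C > 0, ∀ ψ, ‖v ψ ψ‖ ≤ C * T.normSqT ψ}
  add_mem' := by
    rintro v w ⟨hv, C, hC, h⟩ ⟨hw, D, hD, k⟩
    refine ⟨fun ψ φ => ?_, C + D, add_pos hC hD, fun ψ => ?_⟩
    · simp only [LinearMap.add_apply, map_add]
      rw [hv ψ φ, hw ψ φ]
    · simp only [LinearMap.add_apply, add_mul]
      exact (norm_add_le _ _).trans (add_le_add (h ψ) (k ψ))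
  zero_mem' := ⟨fun ψ φ => by simp, 1, one_pos, fun ψ => by simpa using T.normSqT_nonneg ψ⟩
  smul_mem' := by
    rintro c v ⟨hv, C, hC, h⟩
    refine ⟨fun ψ φ => ?_, (|c| + 1) * C, by positivity, fun ψ => ?_⟩
    · simp only [LinearMap.smul_apply, Complex.real_smul, map_mul, Complex.conj_ofReal]
      rw [hv ψ φ]
    · simp only [LinearMap.smul_apply, norm_smul, Real.norm_eq_abs]
      rw [mul_assoc]
      exact mul_le_mul (by linarith) (h ψ) (norm_nonneg _) (by positivity)

/-- The norm of `F(T)`: the supremum of `|v(ψ, ψ)| / ‖ψ‖_T²`. (The quotient is `0` at `ψ = 0`.) -/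
noncomputable def normForm (v : T.SesqForm) : ℝ := ⨆ ψ : T.formDomain, ‖v ψ ψ‖ / T.normSqT ψ

/-- `v` is relatively bounded with respect to the form `t` of `T`, with constants `a` and `b`:
`|v(ψ, ψ)| ≤ a t(ψ, ψ) + b ‖ψ‖²`. -/
def HasRelBound (v : T.SesqForm) (a b : ℝ) : Prop :=
  0 ≤ a ∧ 0 ≤ b ∧ ∀ ψ, ‖v ψ ψ‖ ≤ a * (T.form ψ ψ).re + b * ‖(ψ : H)‖ ^ 2

/-- `C` is the form sum of `T` and `v`: it is self-adjoint and lower semibounded, and the form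
associated with it is `t + v` with domain `Q(T)`. Here the form associated with a self-adjoint
operator `C` with lower bound `μ` has as its domain the domain of `(C - μ)^(1/2)`, and it is
`⟨(C - μ)^(1/2) ψ, (C - μ)^(1/2) φ⟩ + μ ⟨ψ, φ⟩`. -/
def IsFormSum (v : T.SesqForm) (C : H →ₗ.[ℂ] H) : Prop :=
  ∃ (hC : IsSelfAdjoint C) (μ : ℝ) (hμ : IsLowerBound C μ)
    (hQ : (subLowerBound C hC μ hμ).formDomain = T.formDomain),
    ∀ ψ φ : T.formDomain,
      (subLowerBound C hC μ hμ).form ⟨ψ, hQ.ge ψ.2⟩ ⟨φ, hQ.ge φ.2⟩ + μ * inner ℂ (ψ : H) (φ : H) =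
        T.form ψ φ + v ψ φ

end

end PosOp

/-!
Positive operators correspond to closed forms: the operator `(1 + T)^(-1/2)` carries a form `q` on
`Q(T)` that is comparable with `‖·‖_T²` to a bounded, boundedly invertible form on `H`, with
operator `B` say, and `(1 + T)^(-1/2) B⁻¹ (1 + T)^(-1/2)` is then the inverse of the positive
operator whose form is `q`. Form sums arise in this way.

Every `γ ∈ X⁺` is the sum of the operators `|χᵢ⟩⟨χᵢ|`, where `χᵢ = γ^(1/2) eᵢ` for an orthonormal
basis `(eᵢ)`. The vectors `χᵢ` lie in `Q(T)`, and `∑ ‖χᵢ‖_T² = Tr((1 + T)γ)`. The remainders of the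
series stay positive, so it converges in `X`, and a functional `ω ∈ X*` is determined by the
diagonal `ψ ↦ ω(|ψ⟩⟨ψ|)` of a form `v_ω`: `ω(γ) = ∑ v_ω(χᵢ, χᵢ)`. Comparing term by term with
`Tr((1 + T)γ)` shows that `ω ↦ v_ω` is an isometry.

Conversely, given `v`, for large `s` the form `v + s (1 + T)` is the form of a positive operator
`A`, and `Tr(Aγ) - s Tr((1 + T)γ) = ∑ v(χᵢ, χᵢ)` is the functional with form `v`. The same
expansion of `Tr((C - μ)γ)` gives the formula for `ω` by the form sum `C`.
-/

open Filter Topology InnerProductSpace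

/-! ### Sesquilinear forms -/

section

variable {E : Type*} [AddCommGroup E] [Module ℂ E]

theorem sesq_polarization (w : E →ₗ⋆[ℂ] E →ₗ[ℂ] ℂ) (x y : E) :
    w x y = 1 / 4 * ∑ k ∈ Finset.range 4, Complex.I ^ k *
      w (x + (-Complex.I) ^ k • y) (x + (-Complex.I) ^ k • y) := by
  have h2 : Complex.I ^ 2 = -1 := Complex.I_sq
  have h3 : Complex.I ^ 3 = -Complex.I := Complex.I_pow_three
  have h4 : (-Complex.I) ^ 2 = -1 := by rw [neg_sq, h2]
  have h5 : (-Complex.I) ^ 3 = Complex.I := by rw [neg_pow, h3]; ring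
  simp only [Finset.sum_range_succ, Finset.sum_range_zero, pow_zero, pow_one, h2, h3, h4, h5,
    map_add, LinearMap.add_apply, map_smul, LinearMap.map_smulₛₗ, LinearMap.smul_apply,
    smul_eq_mul, map_neg, Complex.conj_I, map_one]
  linear_combination (1 / 2 * w x y - 1 / 2 * w y x) * h2

theorem sesq_ext_diagonal {v w : E →ₗ⋆[ℂ] E →ₗ[ℂ] ℂ} (h : ∀ x, v x x = w x x) : v = w := by
  ext x y
  rw [sesq_polarization v, sesq_polarization w]
  simp only [h]

end

theorem re_inner_self_eq_norm_sq {E : Type*} [SeminormedAddCommGroup E] [InnerProductSpace ℂ E]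
    (x : E) : (inner ℂ x x).re = ‖x‖ ^ 2 :=
  inner_self_eq_norm_sq (𝕜 := ℂ) x

section

variable {E : Type*} [NormedAddCommGroup E] [InnerProductSpace ℂ E]

theorem sum_norm_sq_add_neg_I_pow_smul (x y : E) :
    ∑ k ∈ Finset.range 4, ‖x + (-Complex.I) ^ k • y‖ ^ 2 = 4 * (‖x‖ ^ 2 + ‖y‖ ^ 2) := by
  have h2 : (-Complex.I) ^ 2 = -1 := by rw [neg_sq, Complex.I_sq]
  have h3 : (-Complex.I) ^ 3 = Complex.I := by rw [neg_pow, Complex.I_pow_three]; ring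
  have hy := parallelogram_law_with_norm ℂ x y
  have hIy := parallelogram_law_with_norm ℂ x (Complex.I • y)
  rw [norm_smul, Complex.norm_I, one_mul] at hIy
  simp only [Finset.sum_range_succ, Finset.sum_range_zero, pow_zero, pow_one, h2, h3, neg_smul,
    one_smul, ← sub_eq_add_neg]
  linarith

theorem norm_sesq_le_mul_add_sq {w : E →ₗ⋆[ℂ] E →ₗ[ℂ] ℂ} {C : ℝ}
    (hw : ∀ x, ‖w x x‖ ≤ C * ‖x‖ ^ 2) (x y : E) : ‖w x y‖ ≤ C * (‖x‖ ^ 2 + ‖y‖ ^ 2) := by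
  calc ‖w x y‖ ≤ 1 / 4 * ∑ k ∈ Finset.range 4, C * ‖x + (-Complex.I) ^ k • y‖ ^ 2 := by
        rw [sesq_polarization, norm_mul, norm_div, norm_one, Complex.norm_ofNat]
        gcongr
        refine norm_sum_le_of_le _ fun k _ => ?_
        rw [norm_mul, norm_pow, Complex.norm_I, one_pow, one_mul]
        exact hw _
    _ = C * (‖x‖ ^ 2 + ‖y‖ ^ 2) := by
        rw [← Finset.mul_sum, sum_norm_sq_add_neg_I_pow_smul]
        ring

theorem norm_sesq_le {w : E →ₗ⋆[ℂ] E →ₗ[ℂ] ℂ} {C : ℝ}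
    (hw : ∀ x, ‖w x x‖ ≤ C * ‖x‖ ^ 2) (x y : E) : ‖w x y‖ ≤ 2 * C * ‖x‖ * ‖y‖ := by
  rcases eq_or_ne x 0 with rfl | hx
  · simp
  rcases eq_or_ne y 0 with rfl | hy
  · simp
  have hunit := norm_sesq_le_mul_add_sq hw (((‖x‖⁻¹ : ℝ) : ℂ) • x) (((‖y‖⁻¹ : ℝ) : ℂ) • y)
  rw [map_smul, LinearMap.map_smulₛₗ, LinearMap.smul_apply, norm_smul, norm_smul, norm_smul,
    norm_smul, Complex.conj_ofReal, Complex.norm_real, Complex.norm_real, norm_inv, norm_inv,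
    norm_norm, norm_norm, inv_mul_cancel₀ (norm_ne_zero_iff.mpr hx),
    inv_mul_cancel₀ (norm_ne_zero_iff.mpr hy), ← mul_assoc, ← mul_inv,
    inv_mul_le_iff₀ (by positivity)] at hunit
  linarith

theorem exists_continuousLinearMap_of_sesq [CompleteSpace E] {w : E →ₗ⋆[ℂ] E →ₗ[ℂ] ℂ} {C : ℝ}
    (hw : ∀ x, ‖w x x‖ ≤ C * ‖x‖ ^ 2) : ∃ B : E →L[ℂ] E, ∀ x y, inner ℂ (B x) y = w x y :=
  ⟨continuousLinearMapOfBilin (LinearMap.mkContinuous₂ w (2 * C) (norm_sesq_le hw)), fun x y => by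
    rw [continuousLinearMapOfBilin_apply, LinearMap.mkContinuous₂_apply]⟩

end

namespace PosOp

section

variable {H : Type*} [NormedAddCommGroup H] [InnerProductSpace ℂ H] [CompleteSpace H]
variable (V : PosOp H)

/-! ### Resolvents -/

theorem norm_resolvent_le (ε : Set.Ioi (0 : ℝ)) (y : H) : ‖V.resolvent ε y‖ ≤ ‖y‖ := by
  have h := V.norm_le_oneAddSMul ε ⟨_, V.resolvent_mem ε y⟩
  rwa [oneAddSMul_apply, V.resolvent_right] at h

theorem toPMap_resolvent (ε : Set.Ioi (0 : ℝ)) (x : V.toPMap.domain) :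
    V.toPMap ⟨V.resolvent ε x, V.resolvent_mem ε x⟩ = V.resolvent ε (V.toPMap x) := by
  have h : V.resolvent ε x + ((ε : ℝ) : ℂ) • V.toPMap ⟨V.resolvent ε x, V.resolvent_mem ε x⟩ =
      V.resolvent ε x + ((ε : ℝ) : ℂ) • V.resolvent ε (V.toPMap x) := by
    rw [V.resolvent_right, ← map_smul, ← map_add, V.resolvent_left]
  exact smul_right_injective H (Complex.ofReal_ne_zero.mpr (ne_of_gt ε.2)) (add_left_cancel h)

theorem commute_resolvent (ε δ : Set.Ioi (0 : ℝ)) : Commute (V.resolvent ε) (V.resolvent δ) := by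
  ext y
  set x : V.toPMap.domain := ⟨V.resolvent δ y, V.resolvent_mem δ y⟩
  have hy : V.resolvent ε y =
      V.resolvent ε x + ((δ : ℝ) : ℂ) • V.toPMap ⟨V.resolvent ε x, V.resolvent_mem ε x⟩ := by
    rw [V.toPMap_resolvent, ← map_smul, ← map_add, V.resolvent_right]
  calc V.resolvent ε x = V.resolvent δ (V.resolvent ε y) := by
        rw [hy, V.resolvent_left δ ⟨_, V.resolvent_mem ε x⟩]

theorem norm_resolvent_sub_self_le (ε : Set.Ioi (0 : ℝ)) (x : V.toPMap.domain) :
    ‖V.resolvent ε x - x‖ ≤ ε * ‖V.toPMap x‖ := by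
  have h := V.resolvent_right ε x
  rw [V.toPMap_resolvent] at h
  calc ‖V.resolvent ε x - x‖ = ‖((ε : ℝ) : ℂ) • V.resolvent ε (V.toPMap x)‖ := by
        rw [← norm_neg, neg_sub, ← sub_eq_of_eq_add' h.symm]
    _ = ε * ‖V.resolvent ε (V.toPMap x)‖ := by
        rw [norm_smul, Complex.norm_real, Real.norm_of_nonneg (le_of_lt ε.2)]
    _ ≤ ε * ‖V.toPMap x‖ := mul_le_mul_of_nonneg_left (V.norm_resolvent_le _ _) (le_of_lt ε.2)

theorem tendsto_resolvent (y : H) : Tendsto (fun ε => V.resolvent ε y) atBot (𝓝 y) := by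
  have hequi : Equicontinuous fun ε => (V.resolvent ε : H → H) :=
    (LipschitzWith.uniformEquicontinuous _ 1 fun ε =>
      (V.resolvent ε).lipschitz.weaken (by
        exact_mod_cast (V.resolvent ε).opNorm_le_bound zero_le_one fun x => by
          rw [one_mul]; exact V.norm_resolvent_le ε x)).equicontinuous
  refine V.isSelfAdjoint.dense_domain.induction (P := fun y =>
    Tendsto (fun ε => V.resolvent ε y) atBot (𝓝 y)) (fun x hx => ?_)
    (hequi.isClosed_setOfPred_tendsto continuous_id) y
  have hε : Tendsto (fun ε : Set.Ioi (0 : ℝ) => (ε : ℝ)) atBot (𝓝 0) :=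
    ((map_coe_Ioi_atBot (0 : ℝ)).le.trans nhdsWithin_le_nhds)
  refine tendsto_iff_norm_sub_tendsto_zero.mpr (squeeze_zero (fun _ => norm_nonneg _)
    (fun ε => V.norm_resolvent_sub_self_le ε ⟨x, hx⟩) ?_)
  simpa only [zero_mul] using hε.mul_const ‖V.toPMap ⟨x, hx⟩‖

/-! ### The form of a positive operator -/

/-- The linear map `V^(1/2) : Q(V) → H`. -/
noncomputable def sqrtForm : V.formDomain →ₗ[ℂ] H := V.sqrt.toPMap.toFun

/-- The unitary `(1 + V)^(-1/2)` from `H` onto `Q(V)` with its form norm; it turns bounded forms on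
`Q(V)` into bounded forms on `H`. -/
noncomputable def formEquiv : H ≃ₗ[ℂ] V.formDomain :=
  LinearEquiv.ofInjective V.sqrtRes.toLinearMap V.sqrtRes_injective

theorem coe_formEquiv (x : H) : (V.formEquiv x : H) = V.sqrtRes x := rfl

theorem sqrtForm_formEquiv (x : H) : V.sqrtForm (V.formEquiv x) = V.sqrtOneSubRes x :=
  V.sqrtPMap_apply x _

theorem form_eq_inner (ψ φ : V.formDomain) :
    V.form ψ φ = inner ℂ (V.sqrtForm ψ) (V.sqrtForm φ) := rfl

theorem normSqT_eq (ψ : V.formDomain) : V.normSqT ψ = ‖(ψ : H)‖ ^ 2 + ‖V.sqrtForm ψ‖ ^ 2 := rfl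

theorem form_self (ψ : V.formDomain) : V.form ψ ψ = ((‖V.sqrtForm ψ‖ ^ 2 : ℝ) : ℂ) := by
  rw [form_eq_inner, inner_self_eq_norm_sq_to_K]
  norm_cast

theorem re_form_self (ψ : V.formDomain) : (V.form ψ ψ).re = ‖V.sqrtForm ψ‖ ^ 2 := by
  rw [form_self, Complex.ofReal_re]

theorem inner_add_form_formEquiv (x y : H) :
    inner ℂ (V.formEquiv x : H) (V.formEquiv y) + V.form (V.formEquiv x) (V.formEquiv y) =
      inner ℂ x y := by
  rw [form_eq_inner, sqrtForm_formEquiv, sqrtForm_formEquiv, coe_formEquiv, coe_formEquiv,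
    inner_sqrtRes, inner_sqrtOneSubRes, sqrtRes_sqrtRes, sqrtOneSubRes_sqrtOneSubRes,
    ← inner_add_right, add_sub_cancel]

theorem normSqT_formEquiv (x : H) : V.normSqT (V.formEquiv x) = ‖x‖ ^ 2 := by
  rw [normSqT_eq, ← re_form_self, ← re_inner_self_eq_norm_sq, ← Complex.add_re,
    inner_add_form_formEquiv, re_inner_self_eq_norm_sq]

theorem inner_sqrtForm (ψ φ : V.formDomain) :
    inner ℂ (V.sqrtForm ψ) (φ : H) = inner ℂ (ψ : H) (V.sqrtForm φ) :=
  LinearPMap.symmetric_of_isSelfAdjoint V.sqrt.isSelfAdjoint ψ φ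

/-- The first representation theorem. -/
theorem mem_domain_iff_form (x y : H) :
    (∃ hx : x ∈ V.toPMap.domain, V.toPMap ⟨x, hx⟩ = y) ↔
      ∃ hx : x ∈ V.formDomain, ∀ φ : V.formDomain, V.form φ ⟨x, hx⟩ = inner ℂ (φ : H) y := by
  rw [sqrt_sqrt]
  constructor
  · rintro ⟨hx, hVx, rfl⟩
    exact ⟨hx, fun φ => V.inner_sqrtForm φ ⟨_, hVx⟩⟩
  · rintro ⟨hx, hform⟩
    refine ⟨hx, LinearPMap.mem_domain_of_isSelfAdjoint V.sqrt.isSelfAdjoint _ _ fun φ => ?_⟩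
    rw [← inner_conj_symm, ← hform φ]
    exact inner_conj_symm (V.sqrtForm ⟨x, hx⟩) (V.sqrtForm φ)

theorem domain_le_formDomain : V.toPMap.domain ≤ V.formDomain := fun x hx =>
  ((V.mem_domain_iff_form x _).mp ⟨hx, rfl⟩).1

theorem form_apply_domain (φ : V.formDomain) (x : V.toPMap.domain) :
    V.form φ ⟨x, V.domain_le_formDomain x.2⟩ = inner ℂ (φ : H) (V.toPMap x) :=
  ((V.mem_domain_iff_form x _).mp ⟨x.2, rfl⟩).choose_spec φ

theorem dense_formDomain : Dense (V.formDomain : Set H) :=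
  V.sqrt.isSelfAdjoint.dense_domain

theorem exists_norm_sqrtForm_le_of_tendsto {ι : Type*} {l : Filter ι} [NeBot l]
    {u : ι → V.formDomain} {ψ : H} (hu : Tendsto (fun i => (u i : H)) l (𝓝 ψ)) {f : ι → ℝ} {M : ℝ}
    (hf : Tendsto f l (𝓝 M)) (hle : ∀ i, ‖V.sqrtForm (u i)‖ ≤ f i) :
    ∃ h : ψ ∈ V.formDomain, ‖V.sqrtForm ⟨ψ, h⟩‖ ≤ M := by
  have hbound : ∀ φ : V.formDomain, ‖inner ℂ ψ (V.sqrtForm φ)‖ ≤ M * ‖(φ : H)‖ := by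
    refine fun φ => le_of_tendsto_of_tendsto' (hu.inner tendsto_const_nhds).norm
      (hf.mul_const _) fun i => ?_
    rw [← inner_sqrtForm]
    exact (norm_inner_le_norm _ _).trans (mul_le_mul_of_nonneg_right (hle i) (norm_nonneg _))
  have hψ : ψ ∈ V.formDomain := by
    have hadj : ψ ∈ V.sqrt.toPMap.adjoint.domain := (LinearPMap.mem_adjoint_domain_iff _ _).mpr
      (LinearMap.mkContinuous _ M hbound).continuous
    rwa [LinearPMap.isSelfAdjoint_def.mp V.sqrt.isSelfAdjoint] at hadj
  have hdense : ∀ φ, ‖inner ℂ (V.sqrtForm ⟨ψ, hψ⟩) φ‖ ≤ M * ‖φ‖ := fun φ =>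
    V.dense_formDomain.induction
      (P := fun φ => ‖inner ℂ (V.sqrtForm ⟨ψ, hψ⟩) φ‖ ≤ M * ‖φ‖)
      (fun φ hφ => (V.inner_sqrtForm ⟨ψ, hψ⟩ ⟨φ, hφ⟩).symm ▸ hbound ⟨φ, hφ⟩)
      (isClosed_le (by fun_prop) (by fun_prop)) φ
  have hM : 0 ≤ M := ge_of_tendsto' hf fun i => (norm_nonneg _).trans (hle i)
  have hself := hdense (V.sqrtForm ⟨ψ, hψ⟩)
  rw [inner_self_eq_norm_sq_to_K, norm_pow, RCLike.norm_ofReal, abs_norm, pow_two] at hself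
  exact ⟨hψ, (le_or_gt _ M).elim id fun h => le_of_mul_le_mul_right hself (hM.trans_lt h)⟩

end

section

variable {H : Type*} [NormedAddCommGroup H] [InnerProductSpace ℂ H] [CompleteSpace H]

/-! ### Operators associated with forms -/

theorem dense_sqrtRes_mem_domain (V : PosOp H) : Dense {y | V.sqrtRes y ∈ V.toPMap.domain} := by
  refine V.dense_formDomain.mono ?_
  rintro _ ⟨z, rfl⟩
  change V.sqrtRes (V.sqrtRes z) ∈ V.toPMap.domain
  rw [sqrtRes_sqrtRes]
  exact V.resolvent_mem _ z

theorem exists_sqrtForm_eq_continuousLinearMap {V W : PosOp H} {s : Set H} (hs : Dense s) {c : ℝ}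
    (h : ∀ y ∈ s, ∃ hy : V.sqrtRes y ∈ W.formDomain,
      ‖W.sqrtForm ⟨_, hy⟩‖ ^ 2 ≤ c * V.normSqT (V.formEquiv y)) :
    ∃ G : H →L[ℂ] H, ∀ y, ∃ hy : V.sqrtRes y ∈ W.formDomain, W.sqrtForm ⟨_, hy⟩ = G y := by
  have hext : ∀ y, ∃ hy : V.sqrtRes y ∈ W.formDomain, ‖W.sqrtForm ⟨_, hy⟩‖ ≤ √c * ‖y‖ := fun y => by
    have := mem_closure_iff_comap_neBot.mp (hs y)
    refine W.exists_norm_sqrtForm_le_of_tendsto (l := comap ((↑) : s → H) (𝓝 y))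
      (u := fun z => ⟨V.sqrtRes z, (h z z.2).1⟩) (f := fun z => √c * ‖(z : H)‖)
      ((V.sqrtRes.continuous.tendsto y).comp tendsto_comap)
      ((tendsto_comap.norm).const_mul √c) fun z => ?_
    rw [← Real.sqrt_sq (norm_nonneg (z : H)), ← Real.sqrt_mul' _ (sq_nonneg _),
      ← V.normSqT_formEquiv]
    exact Real.le_sqrt_of_sq_le (h z z.2).2
  choose hmem hle using hext
  exact ⟨(W.sqrtForm ∘ₗ V.sqrtRes.toLinearMap.codRestrict W.formDomain hmem).mkContinuous √c hle,
    fun y => ⟨hmem y, rfl⟩⟩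

/-- `W` is the positive operator associated with the form `q` on `Q(T)`. -/
def HasForm (W : PosOp H) {T : PosOp H} (q : T.SesqForm) : Prop :=
  ∃ h : W.formDomain = T.formDomain, ∀ ψ φ : T.formDomain,
    W.form ⟨ψ, h.ge ψ.2⟩ ⟨φ, h.ge φ.2⟩ = q ψ φ

variable {T W : PosOp H} {q : T.SesqForm}

theorem HasForm.norm_sqrtForm_sq (h : W.HasForm q) (ψ : T.formDomain) :
    ‖W.sqrtForm ⟨ψ, h.1.ge ψ.2⟩‖ ^ 2 = (q ψ ψ).re := by
  rw [← re_form_self, ← h.2 ψ ψ]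

theorem HasForm.mem_domain_iff (h : W.HasForm q) (x y : H) :
    (∃ hx : x ∈ W.toPMap.domain, W.toPMap ⟨x, hx⟩ = y) ↔
      ∃ hx : x ∈ T.formDomain, ∀ φ : T.formDomain, q φ ⟨x, hx⟩ = inner ℂ (φ : H) y := by
  rw [mem_domain_iff_form]
  constructor
  · exact fun ⟨hx, hy⟩ =>
      ⟨h.1.le hx, fun φ => (h.2 φ ⟨x, h.1.le hx⟩).symm.trans (hy ⟨φ, h.1.ge φ.2⟩)⟩
  · exact fun ⟨hx, hy⟩ =>
      ⟨h.1.ge hx, fun φ => (h.2 ⟨φ, h.1.le φ.2⟩ ⟨x, hx⟩).trans (hy ⟨φ, h.1.le φ.2⟩)⟩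

theorem hasForm_of_formDomain_eq {C : ℝ} (hC : ∀ ψ, ‖q ψ ψ‖ ≤ C * T.normSqT ψ)
    (hQ : W.formDomain = T.formDomain) {G : H →L[ℂ] H}
    (hG : ∀ y, W.sqrtForm ⟨T.sqrtRes y, hQ.ge (T.formEquiv y).2⟩ = G y) {s : Set H} (hs : Dense s)
    (hq : ∀ y ∈ s, q (T.formEquiv y) (T.formEquiv y) = inner ℂ (G y) (G y)) : W.HasForm q := by
  obtain ⟨B, hB⟩ := exists_continuousLinearMap_of_sesq
    (w := (q ∘ₛₗ T.formEquiv.toLinearMap).compl₂ T.formEquiv.toLinearMap) (C := C) fun y => by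
      rw [← normSqT_formEquiv]
      exact hC _
  have hGB : ∀ y, inner ℂ (G y) (G y) = inner ℂ (B y) y := fun y =>
    hs.induction (P := fun y => inner ℂ (G y) (G y) = inner ℂ (B y) y)
      (fun y hy => (hq y hy).symm.trans (hB y y).symm) (isClosed_eq (by fun_prop) (by fun_prop)) y
  let sqrtW : T.formDomain →ₗ[ℂ] H := W.sqrtForm ∘ₗ Submodule.inclusion hQ.ge
  have hform : (innerₛₗ ℂ ∘ₛₗ sqrtW).compl₂ sqrtW = q := sesq_ext_diagonal fun ψ => by
    obtain ⟨y, rfl⟩ := T.formEquiv.surjective ψ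
    exact (congrArg₂ (inner ℂ) (hG y) (hG y)).trans ((hGB y).trans (hB y y))
  exact ⟨hQ, fun ψ φ => congrArg (fun w : T.SesqForm => w ψ φ) hform⟩

/-- A criterion on the operator domain alone: it has to be a core of `q`, and the form norm of `W`
has to dominate that of `T` there. -/
theorem hasForm_of_inner_eq {C c : ℝ} (hC : ∀ ψ, ‖q ψ ψ‖ ≤ C * T.normSqT ψ)
    (hWT : W.toPMap.domain ≤ T.formDomain)
    (hW : ∀ x : W.toPMap.domain,
      q ⟨x, hWT x.2⟩ ⟨x, hWT x.2⟩ = inner ℂ (x : H) (W.toPMap x))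
    (hdense : Dense {y | T.sqrtRes y ∈ W.toPMap.domain})
    (hc : ∀ x : W.toPMap.domain,
      T.normSqT ⟨x, hWT x.2⟩ ≤ c * W.normSqT ⟨x, W.domain_le_formDomain x.2⟩) :
    W.HasForm q := by
  have hdiag : ∀ x : W.toPMap.domain, q ⟨x, hWT x.2⟩ ⟨x, hWT x.2⟩ =
      inner ℂ (W.sqrtForm ⟨x, W.domain_le_formDomain x.2⟩)
        (W.sqrtForm ⟨x, W.domain_le_formDomain x.2⟩) := fun x =>
    (hW x).trans (W.form_apply_domain ⟨x, W.domain_le_formDomain x.2⟩ x).symm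
  obtain ⟨G, hG⟩ := exists_sqrtForm_eq_continuousLinearMap (V := T) (W := W) hdense (c := C)
    fun y hy => ⟨W.domain_le_formDomain hy, by
      rw [← re_inner_self_eq_norm_sq, ← hdiag ⟨_, hy⟩]
      exact (Complex.re_le_norm _).trans (hC _)⟩
  obtain ⟨_, hT⟩ := exists_sqrtForm_eq_continuousLinearMap (V := W) (W := T)
    W.dense_sqrtRes_mem_domain (c := c) fun y hy =>
      ⟨hWT hy, (le_add_of_nonneg_left (sq_nonneg _)).trans (hc ⟨_, hy⟩)⟩
  have hQ : W.formDomain = T.formDomain := by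
    refine le_antisymm ?_ ?_
    · rintro _ ⟨y, rfl⟩
      exact (hT y).1
    · rintro _ ⟨y, rfl⟩
      exact (hG y).1
  refine hasForm_of_formDomain_eq hC hQ (fun y => (hG y).2) hdense fun y hy => ?_
  rw [← (hG y).2]
  exact hdiag ⟨_, hy⟩

/-- The inverse of an injective bounded positive operator, as an unbounded positive operator. -/
noncomputable def ofInverse (M : H →L[ℂ] H) (hM : 0 ≤ M) (hi : Function.Injective M) :
    PosOp H where
  toPMap :=
    { domain := LinearMap.range M.toLinearMap
      toFun := (LinearEquiv.ofInjective M.toLinearMap hi).symm.toLinearMap }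
  isSelfAdjoint := by
    have hsymm := ((ContinuousLinearMap.nonneg_iff_isPositive _).mp hM).isSymmetric
    have hinv (x : H) : (LinearEquiv.ofInjective M.toLinearMap hi).symm ⟨M x, ⟨x, rfl⟩⟩ = x :=
      (LinearEquiv.ofInjective M.toLinearMap hi).symm_apply_apply x
    apply LinearPMap.isSelfAdjoint_of_symmetric_of_maximal
    · refine Submodule.dense_iff_topologicalClosure_eq_top.mpr ?_
      rw [Submodule.topologicalClosure_eq_top_iff, hsymm.orthogonal_range]
      exact LinearMap.ker_eq_bot.mpr hi
    · rintro ⟨_, x, rfl⟩ ⟨_, y, rfl⟩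
      change inner ℂ ((LinearEquiv.ofInjective M.toLinearMap hi).symm ⟨M x, _⟩) (M y) =
        inner ℂ (M x) ((LinearEquiv.ofInjective M.toLinearMap hi).symm ⟨M y, _⟩)
      rw [hinv, hinv]
      exact (hsymm x y).symm
    · intro y w hw
      refine ⟨w, ext_inner_right ℂ fun x => ?_⟩
      have hx := hw ⟨M x, ⟨x, rfl⟩⟩
      change inner ℂ w (M x) =
        inner ℂ y ((LinearEquiv.ofInjective M.toLinearMap hi).symm ⟨M x, _⟩) at hx
      rw [hinv] at hx
      exact (hsymm w x).trans hx
  nonneg := by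
    rintro ⟨_, x, rfl⟩
    change 0 ≤ (inner ℂ (M x) ((LinearEquiv.ofInjective M.toLinearMap hi).symm
      (LinearEquiv.ofInjective M.toLinearMap hi x))).re
    rw [LinearEquiv.symm_apply_apply]
    exact ((ContinuousLinearMap.nonneg_iff_isPositive _).mp hM).re_inner_nonneg_left x

theorem ofInverse_apply (M : H →L[ℂ] H) (hM : 0 ≤ M) (hi : Function.Injective M) (z : H) :
    (ofInverse M hM hi).toPMap ⟨M z, ⟨z, rfl⟩⟩ = z :=
  (LinearEquiv.ofInjective M.toLinearMap hi).symm_apply_apply z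

theorem exists_unit_of_form (hq : q ∈ T.formSpace) {c : ℝ} (hc : 0 < c)
    (hcq : ∀ ψ, c * T.normSqT ψ ≤ (q ψ ψ).re) :
    ∃ B : (H →L[ℂ] H)ˣ, 0 ≤ (B : H →L[ℂ] H) ∧
      ∀ x y, inner ℂ ((B : H →L[ℂ] H) x) y = q (T.formEquiv x) (T.formEquiv y) := by
  obtain ⟨hherm, C, -, hC⟩ := hq
  obtain ⟨B, hB⟩ := exists_continuousLinearMap_of_sesq
    (w := (q ∘ₛₗ T.formEquiv.toLinearMap).compl₂ T.formEquiv.toLinearMap) (C := C) fun y => by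
      rw [← normSqT_formEquiv]
      exact hC _
  replace hB : ∀ x y, inner ℂ (B x) y = q (T.formEquiv x) (T.formEquiv y) := hB
  have hcB : ∀ x, ‖x‖ ^ 2 * c ≤ (inner ℂ (B x) x).re := fun x => by
    rw [hB, mul_comm, ← normSqT_formEquiv]
    exact hcq _
  obtain ⟨u, rfl⟩ := ContinuousLinearMap.isUnit_of_forall_le_norm_inner_map B
    (c := ⟨c, hc.le⟩) hc fun x => (hcB x).trans (Complex.re_le_norm _)
  refine ⟨u, (ContinuousLinearMap.nonneg_iff_isPositive _).mpr ⟨fun x y => ?_, fun x => ?_⟩, hB⟩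
  · rw [← inner_conj_symm x]
    exact (hB x y).trans ((hherm _ _).trans (congrArg _ (hB y x).symm))
  · exact (mul_nonneg (sq_nonneg _) hc.le).trans (hcB x)

theorem exists_hasForm (hq : q ∈ T.formSpace) {c : ℝ} (hc : 0 < c)
    (hcq : ∀ ψ, c * T.normSqT ψ ≤ (q ψ ψ).re) : ∃ A : PosOp H, A.HasForm q := by
  obtain ⟨B, hB0, hB⟩ := exists_unit_of_form hq hc hcq
  obtain ⟨-, C, -, hC⟩ := hq
  set G : H →L[ℂ] H := ↑B⁻¹
  have hGB (x : H) : G ((B : H →L[ℂ] H) x) = x := DFunLike.congr_fun B.inv_mul x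
  have hBG (x : H) : (B : H →L[ℂ] H) (G x) = x := DFunLike.congr_fun B.mul_inv x
  have hsymm := ((ContinuousLinearMap.nonneg_iff_isPositive _).mp hB0).isSymmetric
  have hM : 0 ≤ T.sqrtRes * G * T.sqrtRes :=
    (CFC.sqrt_nonneg T.res).isSelfAdjoint.conjugate_nonneg (CFC.inv_nonneg_of_nonneg B hB0)
  have hi : Function.Injective (T.sqrtRes * G * T.sqrtRes) :=
    T.sqrtRes_injective.comp
      ((Function.LeftInverse.injective hBG).comp T.sqrtRes_injective)
  set A := ofInverse (T.sqrtRes * G * T.sqrtRes) hM hi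
  have hAT : A.toPMap.domain ≤ T.formDomain := by
    rintro _ ⟨x, rfl⟩
    exact T.sqrtRes_mem _
  have hA (x : A.toPMap.domain) :
      q ⟨x, hAT x.2⟩ ⟨x, hAT x.2⟩ = inner ℂ (x : H) (A.toPMap x) := by
    obtain ⟨_, z, rfl⟩ := x
    calc q (T.formEquiv (G (T.sqrtRes z))) (T.formEquiv (G (T.sqrtRes z)))
        = inner ℂ (G (T.sqrtRes z)) (T.sqrtRes z) := by
          rw [← hB]; exact (hsymm _ _).trans (congrArg _ (hBG _))
      _ = inner ℂ (T.sqrtRes (G (T.sqrtRes z))) z := (T.inner_sqrtRes _ _).symm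
      _ = _ := congrArg (inner ℂ _) (ofInverse_apply _ hM hi z).symm
  refine ⟨A, hasForm_of_inner_eq (c := c⁻¹) hC hAT hA ?_ fun x => ?_⟩
  · have hdense : Dense (G '' T.formDomain) :=
      (Function.RightInverse.surjective hGB).denseRange.dense_image G.continuous T.dense_formDomain
    refine hdense.mono ?_
    rintro _ ⟨_, ⟨z, rfl⟩, rfl⟩
    exact ⟨z, rfl⟩
  · have hform : (q ⟨x, hAT x.2⟩ ⟨x, hAT x.2⟩).re =
        ‖A.sqrtForm ⟨x, A.domain_le_formDomain x.2⟩‖ ^ 2 := by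
      rw [hA, ← re_form_self, A.form_apply_domain _ x]
    rw [← div_eq_inv_mul, le_div_iff₀' hc]
    exact (hcq _).trans (hform.trans_le (le_add_of_nonneg_left (sq_nonneg _)))

end

section

variable {H : Type*} [NormedAddCommGroup H] [InnerProductSpace ℂ H] [CompleteSpace H]
variable {A T W : PosOp H} {q v : T.SesqForm}

/-- The form of `T`, bundled as a sesquilinear map. -/
noncomputable def formSesq (T : PosOp H) : T.SesqForm :=
  (innerₛₗ ℂ ∘ₛₗ T.sqrtForm).compl₂ T.sqrtForm

/-- The inner product of `H`, as a sesquilinear form on `Q(T)`. -/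
noncomputable def innerSesq (T : PosOp H) : T.SesqForm :=
  (innerₛₗ ℂ ∘ₛₗ T.formDomain.subtype).compl₂ T.formDomain.subtype

theorem formSesq_apply (ψ φ : T.formDomain) : T.formSesq ψ φ = T.form ψ φ := rfl

theorem innerSesq_apply (ψ φ : T.formDomain) : T.innerSesq ψ φ = inner ℂ (ψ : H) (φ : H) := rfl

theorem hasForm_formSesq (T : PosOp H) : T.HasForm T.formSesq := ⟨rfl, fun _ _ => rfl⟩

theorem norm_formSesq_self (ψ : T.formDomain) : ‖T.formSesq ψ ψ‖ = ‖T.sqrtForm ψ‖ ^ 2 := by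
  rw [formSesq_apply, form_self, Complex.norm_real, Real.norm_of_nonneg (sq_nonneg _)]

theorem norm_innerSesq_self (ψ : T.formDomain) : ‖T.innerSesq ψ ψ‖ = ‖(ψ : H)‖ ^ 2 := by
  rw [innerSesq_apply, inner_self_eq_norm_sq_to_K, norm_pow, RCLike.norm_ofReal, abs_norm]

theorem formSesq_mem_formSpace (T : PosOp H) : T.formSesq ∈ T.formSpace :=
  ⟨fun ψ φ => by rw [formSesq_apply, formSesq_apply, form_eq_inner, form_eq_inner, inner_conj_symm],
    1, one_pos, fun ψ => by
      rw [norm_formSesq_self, one_mul, normSqT_eq]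
      exact le_add_of_nonneg_left (sq_nonneg _)⟩

theorem innerSesq_mem_formSpace (T : PosOp H) : T.innerSesq ∈ T.formSpace :=
  ⟨fun ψ φ => by rw [innerSesq_apply, innerSesq_apply, inner_conj_symm],
    1, one_pos, fun ψ => by
      rw [norm_innerSesq_self, one_mul, normSqT_eq]
      exact le_add_of_nonneg_right (sq_nonneg _)⟩

theorem re_formSesq_add_smul_innerSesq_self (v : T.SesqForm) (s : ℝ) (ψ : T.formDomain) :
    ((T.formSesq + v + s • T.innerSesq) ψ ψ).re =
      ‖T.sqrtForm ψ‖ ^ 2 + (v ψ ψ).re + s * ‖(ψ : H)‖ ^ 2 := by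
  rw [LinearMap.add_apply, LinearMap.add_apply, LinearMap.add_apply, LinearMap.add_apply,
    LinearMap.smul_apply, LinearMap.smul_apply, Complex.add_re, Complex.add_re, formSesq_apply,
    re_form_self, Complex.smul_re, innerSesq_apply, re_inner_self_eq_norm_sq, smul_eq_mul]

theorem hasForm_of_apply_eq_add_smul (hdom : W.toPMap.domain = A.toPMap.domain) {s : ℝ}
    (hW : ∀ x, W.toPMap x = A.toPMap ⟨x, hdom.le x.2⟩ + (s : ℂ) • (x : H)) :
    W.HasForm (A.formSesq + s • A.innerSesq) := by
  have hWA : W.toPMap.domain ≤ A.formDomain := hdom.le.trans A.domain_le_formDomain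
  have hdiag (x : W.toPMap.domain) : (A.formSesq + s • A.innerSesq) ⟨x, hWA x.2⟩ ⟨x, hWA x.2⟩ =
      inner ℂ (x : H) (W.toPMap x) := by
    rw [hW, inner_add_right, inner_smul_right,
      ← A.form_apply_domain ⟨x, hWA x.2⟩ ⟨x, hdom.le x.2⟩]
    rfl
  refine hasForm_of_inner_eq (C := 1 + |s|) (c := 1 + |s|) (fun ψ => ?_) hWA hdiag
    (hdom ▸ A.dense_sqrtRes_mem_domain) fun x => ?_
  · calc ‖(A.formSesq + s • A.innerSesq) ψ ψ‖ ≤ ‖A.sqrtForm ψ‖ ^ 2 + |s| * ‖(ψ : H)‖ ^ 2 := by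
          rw [← norm_formSesq_self, ← norm_innerSesq_self, ← Real.norm_eq_abs, ← norm_smul]
          exact norm_add_le _ _
      _ ≤ (1 + |s|) * A.normSqT ψ := by
          rw [normSqT_eq]
          nlinarith [sq_nonneg ‖(ψ : H)‖, abs_nonneg s, sq_nonneg ‖A.sqrtForm ψ‖]
  · have hre := congrArg Complex.re (hdiag x)
    rw [← W.form_apply_domain ⟨x, W.domain_le_formDomain x.2⟩ x, re_form_self,
      ← add_zero A.formSesq, re_formSesq_add_smul_innerSesq_self] at hre
    rw [LinearMap.zero_apply, LinearMap.zero_apply, Complex.zero_re] at hre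
    rw [normSqT_eq, normSqT_eq]
    nlinarith [sq_nonneg ‖(x : H)‖, neg_abs_le s, abs_nonneg s,
      sq_nonneg ‖W.sqrtForm ⟨x, W.domain_le_formDomain x.2⟩‖]

theorem HasForm.of_apply_eq_add_smul (h : A.HasForm q) (hdom : W.toPMap.domain = A.toPMap.domain)
    {s : ℝ} (hW : ∀ x, W.toPMap x = A.toPMap ⟨x, hdom.le x.2⟩ + (s : ℂ) • (x : H)) :
    W.HasForm (q + s • T.innerSesq) := by
  obtain ⟨hQ, hform⟩ := hasForm_of_apply_eq_add_smul hdom hW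
  refine ⟨hQ.trans h.1, fun ψ φ => (hform ⟨ψ, h.1.ge ψ.2⟩ ⟨φ, h.1.ge φ.2⟩).trans ?_⟩
  exact congrArg (· + s • inner ℂ (ψ : H) (φ : H)) (h.2 ψ φ)

theorem hasForm_oneAdd (T : PosOp H) : T.oneAdd.HasForm (T.formSesq + (1 : ℝ) • T.innerSesq) :=
  T.hasForm_formSesq.of_apply_eq_add_smul (W := T.oneAdd) (s := 1) rfl fun _ =>
    (LinearPMap.vadd_apply _ _ _).trans (add_comm _ _)

theorem HasForm.inner_self_apply (h : W.HasForm q) (x : W.toPMap.domain) :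
    ∃ hx : (x : H) ∈ T.formDomain, q ⟨x, hx⟩ ⟨x, hx⟩ = inner ℂ (x : H) (W.toPMap x) :=
  have ⟨hx, hq⟩ := (h.mem_domain_iff x _).mp ⟨x.2, rfl⟩
  ⟨hx, hq ⟨x, hx⟩⟩

/-! ### Form sums -/

theorem subLowerBound_apply {C : H →ₗ.[ℂ] H} (hC : IsSelfAdjoint C) {μ : ℝ}
    (hμ : IsLowerBound C μ) (x : C.domain) :
    (subLowerBound C hC μ hμ).toPMap x = C x - (μ : ℂ) • (x : H) := by
  refine (LinearPMap.vadd_apply _ _ _).trans ?_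
  rw [LinearMap.smul_apply, LinearMap.id_apply, Complex.ofReal_neg, neg_smul, neg_add_eq_sub]

theorem isFormSum_iff {C : H →ₗ.[ℂ] H} : T.IsFormSum v C ↔
    ∃ (hC : IsSelfAdjoint C) (μ : ℝ) (hμ : IsLowerBound C μ),
      (subLowerBound C hC μ hμ).HasForm (T.formSesq + v + (-μ) • T.innerSesq) := by
  refine exists_congr fun hC => exists_congr fun μ => exists_congr fun hμ => exists_congr fun hQ =>
    forall₂_congr fun ψ φ => ?_
  rw [← eq_sub_iff_add_eq, sub_eq_add_neg, ← neg_mul, ← Complex.ofReal_neg, ← Complex.real_smul]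
  rfl

theorem IsFormSum.mem_domain_iff {C : H →ₗ.[ℂ] H} (h : T.IsFormSum v C) (x y : H) :
    (∃ hx : x ∈ C.domain, C ⟨x, hx⟩ = y) ↔
      ∃ hx : x ∈ T.formDomain, ∀ φ : T.formDomain,
        T.form φ ⟨x, hx⟩ + v φ ⟨x, hx⟩ = inner ℂ (φ : H) y := by
  obtain ⟨hC, μ, hμ, h⟩ := isFormSum_iff.mp h
  refine Iff.trans (exists_congr fun hx => ?_) ((h.mem_domain_iff x (y - (μ : ℂ) • x)).trans
    (exists_congr fun hx => forall_congr' fun φ => ?_))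
  · exact sub_left_inj.symm.trans (Eq.congr_left (subLowerBound_apply hC hμ ⟨x, hx⟩).symm)
  · rw [inner_sub_right, inner_smul_right, sub_eq_add_neg, ← neg_mul, ← Complex.ofReal_neg,
      ← Complex.real_smul]
    exact add_left_inj _

theorem IsFormSum.unique {C C' : H →ₗ.[ℂ] H} (h : T.IsFormSum v C) (h' : T.IsFormSum v C') :
    C = C' := by
  refine LinearPMap.eq_of_eq_graph (Submodule.ext fun p => ?_)
  have hgraph (D : H →ₗ.[ℂ] H) : p ∈ D.graph ↔ ∃ hx : p.1 ∈ D.domain, D ⟨p.1, hx⟩ = p.2 :=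
    (LinearPMap.mem_graph_iff' D).trans
      ⟨fun ⟨x, hx⟩ => hx ▸ ⟨x.2, rfl⟩, fun ⟨hx, hy⟩ => ⟨⟨p.1, hx⟩, Prod.ext rfl hy⟩⟩
  rw [hgraph, hgraph, h.mem_domain_iff, h'.mem_domain_iff]

theorem IsFormSum.hasForm_subLowerBound {C : H →ₗ.[ℂ] H} (h : T.IsFormSum v C)
    (hC : IsSelfAdjoint C) {μ : ℝ} (hμ : IsLowerBound C μ) :
    (subLowerBound C hC μ hμ).HasForm (T.formSesq + v + (-μ) • T.innerSesq) := by
  obtain ⟨_, ν, hν, h⟩ := isFormSum_iff.mp h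
  have hshift := h.of_apply_eq_add_smul (W := subLowerBound C hC μ hμ) (s := ν - μ) rfl fun x => by
    change _ = (subLowerBound C hC ν hν).toPMap x + _
    rw [subLowerBound_apply hC hμ x, subLowerBound_apply hC hν x]
    push_cast
    module
  convert hshift using 1
  module

theorem HasRelBound.abs_re_le {a b : ℝ} (h : T.HasRelBound v a b) (ψ : T.formDomain) :
    |(v ψ ψ).re| ≤ a * ‖T.sqrtForm ψ‖ ^ 2 + b * ‖(ψ : H)‖ ^ 2 :=
  (Complex.abs_re_le_norm _).trans ((h.2.2 ψ).trans_eq (by rw [re_form_self]))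

theorem HasRelBound.exists_hasForm {a b : ℝ} (h : T.HasRelBound v a b) (hv : v ∈ T.formSpace)
    (ha : a < 1) : ∃ A : PosOp H, A.HasForm (T.formSesq + v + (b + 1) • T.innerSesq) := by
  refine PosOp.exists_hasForm (T.formSpace.add_mem (T.formSpace.add_mem T.formSesq_mem_formSpace hv)
    (T.formSpace.smul_mem _ T.innerSesq_mem_formSpace)) (sub_pos.mpr ha) fun ψ => ?_
  rw [re_formSesq_add_smul_innerSesq_self, normSqT_eq]
  nlinarith [(abs_le.mp (h.abs_re_le ψ)).1, mul_nonneg h.1 (sq_nonneg ‖(ψ : H)‖)]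

/-- The KLMN theorem. -/
theorem exists_isFormSum (hv : v ∈ T.formSpace) {a b : ℝ} (ha : a < 1)
    (h : T.HasRelBound v a b) : ∃ C : H →ₗ.[ℂ] H, T.IsFormSum v C ∧ IsLowerBound C (-b) := by
  obtain ⟨A, hA⟩ := h.exists_hasForm hv ha
  set C : H →ₗ.[ℂ] H := (((-(b + 1) : ℝ) : ℂ) • (LinearMap.id : H →ₗ[ℂ] H)) +ᵥ A.toPMap
  have hCA (x : A.toPMap.domain) : C x = ((-(b + 1) : ℝ) : ℂ) • (x : H) + A.toPMap x :=
    LinearPMap.vadd_apply _ _ _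
  have hC : IsSelfAdjoint C := LinearPMap.isSelfAdjoint_real_smul_vadd A.isSelfAdjoint _
  have hb : IsLowerBound C (-b) := fun x => by
    obtain ⟨hx, hq⟩ := hA.inner_self_apply x
    have hre := congrArg Complex.re hq
    rw [re_formSesq_add_smul_innerSesq_self] at hre
    rw [hCA, inner_add_right, inner_smul_right, Complex.add_re, Complex.re_ofReal_mul,
      re_inner_self_eq_norm_sq, ← hre]
    nlinarith [(abs_le.mp (h.abs_re_le ⟨x, hx⟩)).1, sq_nonneg ‖T.sqrtForm ⟨x, hx⟩‖]
  refine ⟨C, isFormSum_iff.mpr ⟨hC, -b, hb, ?_⟩, hb⟩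
  have hshift := hA.of_apply_eq_add_smul (W := subLowerBound C hC (-b) hb) (s := -1) rfl fun x => by
    change _ = A.toPMap x + _
    rw [subLowerBound_apply hC hb x, hCA x]
    push_cast
    module
  convert hshift using 1
  module

end

section

variable {H : Type*} [NormedAddCommGroup H] [InnerProductSpace ℂ H] [CompleteSpace H]
variable (V : PosOp H)

/-! ### Yosida approximations -/

theorem resolvent_sqrtRes (ε : Set.Ioi (0 : ℝ)) (x : H) :
    V.resolvent ε (V.sqrtRes x) = V.sqrtRes (V.resolvent ε x) :=
  congrArg (fun f : H →L[ℂ] H => f x)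
    ((V.commute_resolvent ε ⟨1, _⟩).symm.cfcₙ_nnreal NNReal.sqrt).symm

theorem resolvent_sqrtOneSubRes (ε : Set.Ioi (0 : ℝ)) (x : H) :
    V.resolvent ε (V.sqrtOneSubRes x) = V.sqrtOneSubRes (V.resolvent ε x) :=
  congrArg (fun f : H →L[ℂ] H => f x)
    (((Commute.one_right _).sub_right (V.commute_resolvent ε ⟨1, _⟩)).symm.cfcₙ_nnreal
      NNReal.sqrt).symm

theorem sqrtForm_resolvent (ε : Set.Ioi (0 : ℝ)) (ψ : V.formDomain) :
    V.sqrtForm ⟨V.resolvent ε ψ, V.domain_le_formDomain (V.resolvent_mem ε ψ)⟩ =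
      V.resolvent ε (V.sqrtForm ψ) := by
  obtain ⟨x, rfl⟩ := V.formEquiv.surjective ψ
  rw [sqrtForm_formEquiv, resolvent_sqrtOneSubRes, ← sqrtForm_formEquiv]
  exact congrArg V.sqrtForm (Subtype.ext (V.resolvent_sqrtRes ε x))

theorem inner_yosida (ε : Set.Ioi (0 : ℝ)) (ψ : V.formDomain) :
    inner ℂ (ψ : H) (V.yosida ε ψ) =
      inner ℂ (V.sqrtForm ψ) (V.resolvent ε (V.sqrtForm ψ)) := by
  rw [yosida_apply, ← V.form_apply_domain ψ ⟨_, V.resolvent_mem ε ψ⟩, form_eq_inner]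
  exact congrArg _ (V.sqrtForm_resolvent ε ψ)

theorem re_inner_yosida_le (ε : Set.Ioi (0 : ℝ)) (ψ : V.formDomain) :
    (inner ℂ (ψ : H) (V.yosida ε ψ)).re ≤ ‖V.sqrtForm ψ‖ ^ 2 := by
  rw [inner_yosida, sq]
  exact (Complex.re_le_norm _).trans ((norm_inner_le_norm _ _).trans
    (mul_le_mul_of_nonneg_left (V.norm_resolvent_le _ _) (norm_nonneg _)))

theorem tendsto_re_inner_yosida (ψ : V.formDomain) :
    Tendsto (fun ε => (inner ℂ (ψ : H) (V.yosida ε ψ)).re) atBot (𝓝 (‖V.sqrtForm ψ‖ ^ 2)) := by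
  simp only [inner_yosida]
  rw [← re_inner_self_eq_norm_sq]
  exact (Complex.continuous_re.tendsto _).comp (tendsto_const_nhds.inner (V.tendsto_resolvent _))

theorem norm_sqrtForm_resolvent_sq_le (ε : Set.Ioi (0 : ℝ)) (x : H) :
    ‖V.sqrtForm ⟨V.resolvent ε x, V.domain_le_formDomain (V.resolvent_mem ε x)⟩‖ ^ 2 ≤
      (inner ℂ x (V.yosida ε x)).re := by
  have hx : V.resolvent ε x + ((ε : ℝ) : ℂ) • V.yosida ε x = x := by
    rw [yosida_apply, resolvent_right]
  calc _ = (inner ℂ (V.resolvent ε x) (V.yosida ε x)).re := by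
        rw [← re_form_self, V.form_apply_domain _ ⟨_, V.resolvent_mem ε x⟩, yosida_apply]
    _ ≤ (inner ℂ (V.resolvent ε x) (V.yosida ε x)).re + ε * ‖V.yosida ε x‖ ^ 2 :=
        le_add_of_nonneg_right (mul_nonneg (le_of_lt ε.2) (sq_nonneg _))
    _ = (inner ℂ (V.resolvent ε x + ((ε : ℝ) : ℂ) • V.yosida ε x) (V.yosida ε x)).re := by
        rw [inner_add_left, inner_smul_left, Complex.conj_ofReal, Complex.add_re,
          Complex.re_ofReal_mul, re_inner_self_eq_norm_sq]
    _ = (inner ℂ x (V.yosida ε x)).re := by rw [hx]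

theorem re_inner_yosida_nonneg (ε : Set.Ioi (0 : ℝ)) (x : H) :
    0 ≤ (inner ℂ x (V.yosida ε x)).re :=
  (sq_nonneg _).trans (V.norm_sqrtForm_resolvent_sq_le ε x)

theorem mem_formDomain_of_re_inner_yosida_le {ψ : H} {M : ℝ}
    (h : ∀ ε, (inner ℂ ψ (V.yosida ε ψ)).re ≤ M) : ψ ∈ V.formDomain :=
  (V.exists_norm_sqrtForm_le_of_tendsto (u := fun ε => ⟨V.resolvent ε ψ, _⟩)
    (V.tendsto_resolvent ψ) tendsto_const_nhds fun ε =>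
      Real.le_sqrt_of_sq_le ((V.norm_sqrtForm_resolvent_sq_le ε ψ).trans (h ε))).1

end

end PosOp

/-! ### Traces -/

section

variable {H : Type*} [NormedAddCommGroup H] [InnerProductSpace ℂ H] [CompleteSpace H]

theorem summable_norm_inner_onb_sq {A : H →L[ℂ] H} (hA : Summable fun i => ‖A (onb H i)‖ ^ 2) :
    Summable fun p : onbSet H × onbSet H => ‖inner ℂ (onb H p.2) (A (onb H p.1))‖ ^ 2 :=
  (summable_prod_of_nonneg fun _ => sq_nonneg _).mpr
    ⟨fun i => (hasSum_onb_sq (A (onb H i))).summable,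
      hA.congr fun i => (hasSum_onb_sq (A (onb H i))).tsum_eq.symm⟩

/-- `Tr (A B) = Tr (B A)` for Hilbert–Schmidt operators `A` and `B`. -/
theorem tsum_inner_adjoint_comm {A B : H →L[ℂ] H} (hA : Summable fun i => ‖A (onb H i)‖ ^ 2)
    (hB : Summable fun i => ‖B (onb H i)‖ ^ 2) :
    ∑' i, inner ℂ (A.adjoint (onb H i)) (B (onb H i)) =
      ∑' i, inner ℂ (B.adjoint (onb H i)) (A (onb H i)) := by
  have hsum : Summable (Function.uncurry fun i j : onbSet H =>
      inner ℂ (onb H i) (A (onb H j)) * inner ℂ (onb H j) (B (onb H i))) := by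
    refine Summable.of_norm_bounded ((summable_norm_inner_onb_sq hA).prod_symm.add
      (summable_norm_inner_onb_sq hB)) fun p => ?_
    rw [Function.uncurry, norm_mul, Prod.fst_swap, Prod.snd_swap]
    linarith [two_mul_le_add_sq ‖inner ℂ (onb H p.1) (A (onb H p.2))‖
      ‖inner ℂ (onb H p.2) (B (onb H p.1))‖, sq_nonneg ‖inner ℂ (onb H p.1) (A (onb H p.2))‖,
      sq_nonneg ‖inner ℂ (onb H p.2) (B (onb H p.1))‖]
  calc _ = ∑' i, ∑' j, inner ℂ (onb H i) (A (onb H j)) * inner ℂ (onb H j) (B (onb H i)) := by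
        refine tsum_congr fun i => ?_
        rw [← (onb H).tsum_inner_mul_inner]
        simp only [ContinuousLinearMap.adjoint_inner_left]
    _ = ∑' j, ∑' i, inner ℂ (onb H i) (A (onb H j)) * inner ℂ (onb H j) (B (onb H i)) :=
        hsum.tsum_comm.symm
    _ = _ := by
        refine tsum_congr fun j => ?_
        rw [← (onb H).tsum_inner_mul_inner]
        simp only [ContinuousLinearMap.adjoint_inner_left, mul_comm]

/-- The vectors `χ_i = γ^(1/2) e_i`, for which `γ = ∑ |χ_i⟩⟨χ_i|`. -/
noncomputable def sqrtVec (γ : H →L[ℂ] H) (i : onbSet H) : H := CFC.sqrt γ (onb H i)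

theorem cfcSqrt_cfcSqrt_apply {γ : H →L[ℂ] H} (h : 0 ≤ γ) (x : H) :
    CFC.sqrt γ (CFC.sqrt γ x) = γ x :=
  congrArg (fun f : H →L[ℂ] H => f x) (CFC.sqrt_mul_sqrt_self γ h)

theorem inner_cfcSqrt (γ : H →L[ℂ] H) (x y : H) :
    inner ℂ (CFC.sqrt γ x) y = inner ℂ x (CFC.sqrt γ y) :=
  ((ContinuousLinearMap.nonneg_iff_isPositive _).mp (CFC.sqrt_nonneg γ)).1 x y

theorem summable_norm_sqrtVec_sq {γ : H →L[ℂ] H} (hγ : γ ∈ positiveTraceClass H) :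
    Summable fun i => ‖sqrtVec γ i‖ ^ 2 :=
  ((isTraceClass_iff_of_nonneg hγ.1).mp hγ.2).congr fun i => by
    rw [← cfcSqrt_cfcSqrt_apply hγ.1, ← inner_cfcSqrt, re_inner_self_eq_norm_sq, sqrtVec]

theorem hasSum_opTrace_mul {γ : H →L[ℂ] H} (hγ : γ ∈ positiveTraceClass H) (B : H →L[ℂ] H) :
    HasSum (fun i => inner ℂ (sqrtVec γ i) (B (sqrtVec γ i))) (opTrace (B * γ)) := by
  have hχ := summable_norm_sqrtVec_sq hγ
  have hBχ : Summable fun i => ‖(B * CFC.sqrt γ) (onb H i)‖ ^ 2 := by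
    refine Summable.of_nonneg_of_le (fun _ => sq_nonneg _) (fun i => ?_) (hχ.mul_left (‖B‖ ^ 2))
    rw [← mul_pow]
    gcongr
    exact B.le_opNorm _
  have hsum : Summable fun i => inner ℂ (sqrtVec γ i) (B (sqrtVec γ i)) := by
    refine Summable.of_norm_bounded (hχ.mul_left ‖B‖) fun i => (norm_inner_le_norm _ _).trans ?_
    rw [sq, ← mul_assoc, mul_comm]
    gcongr
    exact B.le_opNorm _
  have htrace : opTrace (B * γ) = ∑' i, inner ℂ (sqrtVec γ i) (B (sqrtVec γ i)) :=
    calc opTrace (B * γ)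
        = ∑' i, inner ℂ ((B * CFC.sqrt γ).adjoint (onb H i)) (CFC.sqrt γ (onb H i)) :=
          tsum_congr fun i => by
            rw [ContinuousLinearMap.adjoint_inner_left, mul_apply_eq_comp,
              mul_apply_eq_comp, cfcSqrt_cfcSqrt_apply hγ.1]
      _ = ∑' i, inner ℂ ((CFC.sqrt γ).adjoint (onb H i)) ((B * CFC.sqrt γ) (onb H i)) :=
          tsum_inner_adjoint_comm hBχ hχ
      _ = ∑' i, inner ℂ (sqrtVec γ i) (B (sqrtVec γ i)) :=
          tsum_congr fun i => by
            rw [ContinuousLinearMap.adjoint_inner_left, ← inner_cfcSqrt]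
            rfl
  rw [htrace]
  exact hsum.hasSum

theorem hasSum_re_opTrace_mul {γ : H →L[ℂ] H} (hγ : γ ∈ positiveTraceClass H) (B : H →L[ℂ] H) :
    HasSum (fun i => (inner ℂ (sqrtVec γ i) (B (sqrtVec γ i))).re) (opTrace (B * γ)).re :=
  Complex.hasSum_re (hasSum_opTrace_mul hγ B)

theorem hasSum_re_opTrace {γ : H →L[ℂ] H} (hγ : γ ∈ positiveTraceClass H) :
    HasSum (fun i => ‖sqrtVec γ i‖ ^ 2) (opTrace γ).re := by
  simpa only [one_mul, one_apply_eq_self, re_inner_self_eq_norm_sq] using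
    hasSum_re_opTrace_mul hγ 1

theorem opTrace_mul_add (B : H →L[ℂ] H) {γ δ : H →L[ℂ] H} (hγ : γ ∈ positiveTraceClass H)
    (hδ : δ ∈ positiveTraceClass H) :
    opTrace (B * (γ + δ)) = opTrace (B * γ) + opTrace (B * δ) := by
  rw [opTrace, opTrace, opTrace,
    ← (summable_trace_mul B hγ).tsum_add (summable_trace_mul B hδ)]
  simp only [mul_add, add_apply, inner_add_right]

theorem mem_positiveTraceClass_of_le {γ δ : H →L[ℂ] H} (hδ : 0 ≤ δ) (hle : δ ≤ γ)
    (hγ : γ ∈ positiveTraceClass H) : δ ∈ positiveTraceClass H := by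
  refine ⟨hδ, (isTraceClass_iff_of_nonneg hδ).mpr (Summable.of_nonneg_of_le (fun i => ?_)
    (fun i => ?_) ((isTraceClass_iff_of_nonneg hγ.1).mp hγ.2))⟩
  · exact ((ContinuousLinearMap.nonneg_iff_isPositive _).mp hδ).re_inner_nonneg_right _
  · have h := ((ContinuousLinearMap.le_def _ _).mp hle).re_inner_nonneg_right (onb H i)
    rw [sub_apply, inner_sub_right, map_sub] at h
    exact sub_nonneg.mp h

theorem re_opTrace_mul_le {B : H →L[ℂ] H} (hB : ∀ x, 0 ≤ (inner ℂ x (B x)).re)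
    {γ δ : H →L[ℂ] H} (hδ : 0 ≤ δ) (hle : δ ≤ γ) (hγ : γ ∈ positiveTraceClass H) :
    (opTrace (B * δ)).re ≤ (opTrace (B * γ)).re := by
  have hδ' := mem_positiveTraceClass_of_le hδ hle hγ
  have hsub : γ - δ ∈ positiveTraceClass H :=
    mem_positiveTraceClass_of_le (sub_nonneg.mpr hle) (sub_le_self _ hδ) hγ
  rw [← sub_add_cancel γ δ, opTrace_mul_add B hsub hδ', Complex.add_re]
  exact le_add_of_nonneg_left ((hasSum_re_opTrace_mul hsub B).nonneg fun i => hB _)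

theorem hasSum_mul_rankOne (B : H →L[ℂ] H) (ψ : H) :
    HasSum (fun i => inner ℂ (onb H i) ((B * rankOne ℂ ψ ψ) (onb H i))) (inner ℂ ψ (B ψ)) := by
  simpa only [mul_apply_eq_comp, rankOne_apply, map_smul, inner_smul_right] using
    (onb H).hasSum_inner_mul_inner ψ (B ψ)

theorem opTrace_mul_rankOne (B : H →L[ℂ] H) (ψ : H) :
    opTrace (B * rankOne ℂ ψ ψ) = inner ℂ ψ (B ψ) :=
  (hasSum_mul_rankOne B ψ).tsum_eq

theorem rankOne_self_mem_positiveTraceClass (ψ : H) : rankOne ℂ ψ ψ ∈ positiveTraceClass H := by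
  have hψ : 0 ≤ rankOne ℂ ψ ψ :=
    (ContinuousLinearMap.nonneg_iff_isPositive _).mpr (isPositive_rankOne_self ψ)
  refine ⟨hψ, (isTraceClass_iff_of_nonneg hψ).mpr ?_⟩
  simpa only [one_mul] using (Complex.hasSum_re (hasSum_mul_rankOne 1 ψ)).summable

theorem sum_rankOne_onb_le_one (s : Finset (onbSet H)) :
    ∑ i ∈ s, rankOne ℂ (onb H i) (onb H i) ≤ 1 := by
  refine (ContinuousLinearMap.le_def _ _).mpr ⟨?_, fun x => ?_⟩
  · exact ((IsSelfAdjoint.one _).sub (isSelfAdjoint_sum _ fun i _ =>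
      (isPositive_rankOne_self (onb H i)).isSelfAdjoint)).isSymmetric
  · have h := (onb H).orthonormal.sum_inner_products_le x (s := s)
    rw [ContinuousLinearMap.reApplyInnerSelf_apply, sub_apply, inner_sub_left, map_sub,
      one_apply_eq_self, inner_self_eq_norm_sq, sub_nonneg, sum_apply, sum_inner, map_sum]
    refine le_trans (le_of_eq (Finset.sum_congr rfl fun i _ => ?_)) h
    rw [rankOne_apply, inner_smul_left, ← Complex.normSq_eq_conj_mul_self]
    exact Complex.normSq_eq_norm_sq _

theorem sum_rankOne_sqrtVec_le {γ : H →L[ℂ] H} (hγ : 0 ≤ γ) (s : Finset (onbSet H)) :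
    ∑ i ∈ s, rankOne ℂ (sqrtVec γ i) (sqrtVec γ i) ≤ γ := by
  calc ∑ i ∈ s, rankOne ℂ (sqrtVec γ i) (sqrtVec γ i)
      = CFC.sqrt γ * (∑ i ∈ s, rankOne ℂ (onb H i) (onb H i)) * CFC.sqrt γ := by
        rw [Finset.mul_sum, Finset.sum_mul]
        refine Finset.sum_congr rfl fun i _ => ?_
        ext x
        rw [mul_apply_eq_comp, mul_apply_eq_comp, rankOne_apply,
          rankOne_apply, map_smul, ← inner_cfcSqrt, sqrtVec]
    _ ≤ CFC.sqrt γ * 1 * CFC.sqrt γ :=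
        (CFC.sqrt_nonneg γ).isSelfAdjoint.conjugate_le_conjugate (sum_rankOne_onb_le_one s)
    _ = γ := by rw [mul_one, CFC.sqrt_mul_sqrt_self γ hγ]

end

namespace PosOp

section

variable {H : Type*} [NormedAddCommGroup H] [InnerProductSpace ℂ H] [CompleteSpace H]
variable (V T : PosOp H) {W : PosOp H} {q : T.SesqForm} {γ : H →L[ℂ] H}

/-! ### The trace `Tr (V γ)` -/

theorem re_opTrace_yosida_le (hγ : γ ∈ V.XPlus) (ε : Set.Ioi (0 : ℝ)) :
    (opTrace (V.yosida ε * γ)).re ≤ (V.traceMul γ).toReal :=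
  (ENNReal.ofReal_le_iff_le_toReal hγ.2.ne).mp
    (le_iSup (fun ε => ENNReal.ofReal (opTrace (V.yosida ε * γ)).re) ε)

theorem sqrtVec_mem_formDomain (hγ : γ ∈ V.XPlus) (i : onbSet H) :
    sqrtVec γ i ∈ V.formDomain :=
  V.mem_formDomain_of_re_inner_yosida_le fun ε =>
    (le_hasSum (hasSum_re_opTrace_mul hγ.1 (V.yosida ε)) i fun _ _ =>
      V.re_inner_yosida_nonneg _ _).trans (V.re_opTrace_yosida_le hγ ε)

/-- The vectors `sqrtVec γ i` as elements of the form domain. -/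
noncomputable def formVec (hγ : γ ∈ V.XPlus) (i : onbSet H) : V.formDomain :=
  ⟨sqrtVec γ i, V.sqrtVec_mem_formDomain hγ i⟩

theorem summable_norm_sqrtForm_formVec_sq (hγ : γ ∈ V.XPlus) :
    Summable fun i => ‖V.sqrtForm (V.formVec hγ i)‖ ^ 2 := by
  refine summable_of_sum_le (c := (V.traceMul γ).toReal) (fun _ => sq_nonneg _) fun s => ?_
  refine le_of_tendsto' (tendsto_finsetSum s fun i _ =>
    V.tendsto_re_inner_yosida (V.formVec hγ i)) fun ε => ?_
  exact (sum_le_hasSum s (fun _ _ => V.re_inner_yosida_nonneg _ _)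
    (hasSum_re_opTrace_mul hγ.1 (V.yosida ε))).trans (V.re_opTrace_yosida_le hγ ε)

theorem tendsto_opTrace_yosida_tsum (hγ : γ ∈ V.XPlus) :
    Tendsto (fun ε => (opTrace (V.yosida ε * γ)).re) atBot
      (𝓝 (∑' i, ‖V.sqrtForm (V.formVec hγ i)‖ ^ 2)) := by
  simp only [← (hasSum_re_opTrace_mul hγ.1 _).tsum_eq]
  refine tendsto_tsum_of_dominated_convergence (V.summable_norm_sqrtForm_formVec_sq hγ)
    (fun i => V.tendsto_re_inner_yosida (V.formVec hγ i)) (Eventually.of_forall fun ε i => ?_)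
  rw [Real.norm_of_nonneg (V.re_inner_yosida_nonneg _ _)]
  exact V.re_inner_yosida_le _ (V.formVec hγ i)

theorem mem_XPlus_of_summable (hγ : γ ∈ positiveTraceClass H)
    (h : ∀ i, sqrtVec γ i ∈ V.formDomain)
    (hs : Summable fun i => ‖V.sqrtForm ⟨sqrtVec γ i, h i⟩‖ ^ 2) : γ ∈ V.XPlus :=
  ⟨hγ, (iSup_le fun ε => ENNReal.ofReal_le_ofReal (hasSum_le
    (fun i => V.re_inner_yosida_le ε ⟨_, h i⟩) (hasSum_re_opTrace_mul hγ (V.yosida ε))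
      hs.hasSum)).trans_lt ENNReal.ofReal_lt_top⟩

theorem hasSum_traceMul (hγ : γ ∈ V.XPlus) :
    HasSum (fun i => ‖V.sqrtForm (V.formVec hγ i)‖ ^ 2) (V.traceMul γ).toReal := by
  have hs := V.summable_norm_sqrtForm_formVec_sq hγ
  refine hs.hasSum_iff.mpr (le_antisymm ?_ ?_)
  · exact le_of_tendsto' (V.tendsto_opTrace_yosida_tsum hγ) (V.re_opTrace_yosida_le hγ)
  · refine ENNReal.toReal_le_of_le_ofReal (tsum_nonneg fun _ => sq_nonneg _)
      (iSup_le fun ε => ENNReal.ofReal_le_ofReal ?_)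
    exact hasSum_le (fun i => V.re_inner_yosida_le ε (V.formVec hγ i))
      (hasSum_re_opTrace_mul hγ.1 (V.yosida ε)) hs.hasSum

theorem tendsto_opTrace_yosida (hγ : γ ∈ V.XPlus) :
    Tendsto (fun ε => (opTrace (V.yosida ε * γ)).re) atBot (𝓝 (V.traceMul γ).toReal) :=
  (V.hasSum_traceMul hγ).tsum_eq ▸ V.tendsto_opTrace_yosida_tsum hγ

theorem rankOne_mem_XPlus (ψ : V.formDomain) : rankOne ℂ (ψ : H) (ψ : H) ∈ V.XPlus := by
  refine ⟨rankOne_self_mem_positiveTraceClass _, (iSup_le fun ε => ?_).trans_lt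
    (ENNReal.ofReal_lt_top (r := ‖V.sqrtForm ψ‖ ^ 2))⟩
  rw [opTrace_mul_rankOne]
  exact ENNReal.ofReal_le_ofReal (V.re_inner_yosida_le ε ψ)

theorem traceMul_rankOne (ψ : V.formDomain) :
    (V.traceMul (rankOne ℂ (ψ : H) (ψ : H))).toReal = ‖V.sqrtForm ψ‖ ^ 2 := by
  refine tendsto_nhds_unique (V.tendsto_opTrace_yosida (V.rankOne_mem_XPlus ψ)) ?_
  simpa only [opTrace_mul_rankOne] using V.tendsto_re_inner_yosida ψ

theorem mem_XPlus_of_le {δ : H →L[ℂ] H} (hδ : 0 ≤ δ) (hle : δ ≤ γ) (hγ : γ ∈ V.XPlus) :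
    δ ∈ V.XPlus :=
  ⟨mem_positiveTraceClass_of_le hδ hle hγ.1, (iSup_mono fun ε => ENNReal.ofReal_le_ofReal
    (re_opTrace_mul_le (V.re_inner_yosida_nonneg ε) hδ hle hγ.1)).trans_lt hγ.2⟩

theorem sub_sum_rankOne_mem_XPlus (hγ : γ ∈ V.XPlus) (s : Finset (onbSet H)) :
    γ - ∑ i ∈ s, rankOne ℂ (sqrtVec γ i) (sqrtVec γ i) ∈ V.XPlus := by
  refine V.mem_XPlus_of_le (sub_nonneg.mpr (sum_rankOne_sqrtVec_le hγ.1.1 s))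
    (sub_le_self _ (Finset.sum_nonneg fun i _ => ?_)) hγ
  exact (rankOne_self_mem_positiveTraceClass _).1

/-! ### Traces and forms -/

theorem hasSum_normSqT_add (hγ : γ ∈ T.XPlus) :
    HasSum (fun i => T.normSqT (T.formVec hγ i)) ((opTrace γ).re + (T.traceMul γ).toReal) :=
  (hasSum_re_opTrace hγ.1).add (T.hasSum_traceMul hγ)

variable {T}

theorem HasForm.XPlus_subset (h : W.HasForm q) (hq : q ∈ T.formSpace) : T.XPlus ⊆ W.XPlus := by
  obtain ⟨-, C, -, hC⟩ := hq
  intro γ hγ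
  refine W.mem_XPlus_of_summable hγ.1 (fun i => h.1.ge (T.sqrtVec_mem_formDomain hγ i))
    (Summable.of_nonneg_of_le (fun _ => sq_nonneg _) (fun i => ?_)
      ((T.hasSum_normSqT_add hγ).summable.mul_left C))
  exact (h.norm_sqrtForm_sq (T.formVec hγ i)).trans_le ((Complex.re_le_norm _).trans (hC _))

theorem HasForm.hasSum_traceMul (h : W.HasForm q) (hq : q ∈ T.formSpace) (hγ : γ ∈ T.XPlus) :
    HasSum (fun i => (q (T.formVec hγ i) (T.formVec hγ i)).re) (W.traceMul γ).toReal :=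
  (W.hasSum_traceMul (h.XPlus_subset hq hγ)).congr_fun fun i =>
    (h.norm_sqrtForm_sq (T.formVec hγ i)).symm

theorem HasForm.traceMul_rankOne (h : W.HasForm q) (ψ : T.formDomain) :
    (W.traceMul (rankOne ℂ (ψ : H) (ψ : H))).toReal = (q ψ ψ).re :=
  (W.traceMul_rankOne ⟨ψ, h.1.ge ψ.2⟩).trans (h.norm_sqrtForm_sq ψ)

end

section

variable {H : Type*} [NormedAddCommGroup H] [InnerProductSpace ℂ H] [CompleteSpace H]
variable (T : PosOp H) {W : PosOp H} {γ a b : H →L[ℂ] H}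

/-! ### The space `X` -/

theorem mem_X_of_mem_XPlus (hγ : γ ∈ T.XPlus) : γ ∈ T.X :=
  ⟨γ, hγ, 0, T.XPlus_zero, (sub_zero γ).symm⟩

theorem rankOne_mem_X (ψ : T.formDomain) : rankOne ℂ (ψ : H) (ψ : H) ∈ T.X :=
  T.mem_X_of_mem_XPlus (T.rankOne_mem_XPlus ψ)

/-- The operator `|ψ⟩⟨ψ|` as an element of `X`. -/
noncomputable def rankOneX (ψ : T.formDomain) : T.X := ⟨_, T.rankOne_mem_X ψ⟩

theorem map_eq_sub {M : Type*} [AddCommGroup M] [Module ℝ M] (ω : T.X →ₗ[ℝ] M) (γ : T.X)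
    (ha : a ∈ T.XPlus) (hb : b ∈ T.XPlus) (h : (γ : H →L[ℂ] H) = a - b) :
    ω γ = ω ⟨a, T.mem_X_of_mem_XPlus ha⟩ - ω ⟨b, T.mem_X_of_mem_XPlus hb⟩ := by
  rw [← map_sub]
  exact congrArg ω (Subtype.ext h)

theorem summable_trace_mul_X (B : H →L[ℂ] H) (γ : T.X) :
    Summable fun i => inner ℂ (onb H i) ((B * (γ : H →L[ℂ] H)) (onb H i)) := by
  obtain ⟨_, a, ha, b, hb, rfl⟩ := γ
  refine ((summable_trace_mul B ha.1).sub (summable_trace_mul B hb.1)).congr fun i => ?_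
  rw [mul_sub, sub_apply, inner_sub_right]

/-- The functional `γ ↦ Re Tr (B γ)` on `X`, for a bounded operator `B`. -/
noncomputable def traceFunctional (B : H →L[ℂ] H) : T.X →ₗ[ℝ] ℝ where
  toFun γ := (opTrace (B * (γ : H →L[ℂ] H))).re
  map_add' γ δ := by
    rw [← Complex.add_re, opTrace, opTrace, opTrace,
      ← (T.summable_trace_mul_X B γ).tsum_add (T.summable_trace_mul_X B δ)]
    simp only [Submodule.coe_add, mul_add, add_apply, inner_add_right]
  map_smul' c γ := by
    rw [RingHom.id_apply, smul_eq_mul, ← Complex.re_ofReal_mul, opTrace, opTrace, ← tsum_mul_left]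
    simp only [Submodule.coe_smul, mul_smul_comm, smul_apply, ← Complex.coe_smul, inner_smul_right]

theorem traceFunctional_one (γ : T.X) : T.traceFunctional 1 γ = (opTrace (γ : H →L[ℂ] H)).re :=
  congrArg (fun A => (opTrace A).re) (one_mul _)

theorem re_opTrace_sub (ha : a ∈ T.XPlus) (hb : b ∈ T.XPlus) :
    (opTrace (a - b)).re = (opTrace a).re - (opTrace b).re := by
  have hsub : a - b ∈ T.X := ⟨a, ha, b, hb, rfl⟩
  simpa only [traceFunctional_one] using T.map_eq_sub (T.traceFunctional 1) ⟨_, hsub⟩ ha hb rfl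

variable {T}

theorem exists_tendsto_traceFunctional_yosida (h : T.XPlus ⊆ W.XPlus) (γ : T.X) :
    ∃ r, Tendsto (fun ε => T.traceFunctional (W.yosida ε) γ) atBot (𝓝 r) := by
  obtain ⟨a, ha, b, hb, hab⟩ := γ.2
  refine ⟨_, Tendsto.congr (fun ε => (T.map_eq_sub _ γ ha hb hab).symm)
    ((W.tendsto_opTrace_yosida (h ha)).sub (W.tendsto_opTrace_yosida (h hb)))⟩

/-- The linear functional on `X` that extends `γ ↦ Tr (W γ)` from `X⁺`. -/
noncomputable def traceMulFunctional (h : T.XPlus ⊆ W.XPlus) : T.X →ₗ[ℝ] ℝ :=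
  linearMapOfTendsto (fun γ => limUnder atBot fun ε => T.traceFunctional (W.yosida ε) γ)
    (fun ε => T.traceFunctional (W.yosida ε))
    (tendsto_pi_nhds.mpr fun γ =>
      tendsto_nhds_limUnder (exists_tendsto_traceFunctional_yosida h γ))

theorem traceMulFunctional_apply (h : T.XPlus ⊆ W.XPlus) (hγ : γ ∈ T.XPlus) :
    traceMulFunctional h ⟨γ, T.mem_X_of_mem_XPlus hγ⟩ = (W.traceMul γ).toReal :=
  (W.tendsto_opTrace_yosida (h hγ)).limUnder_eq

/-! ### The norm of `X` -/

variable (T)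

theorem formSesq_add_innerSesq_mem_formSpace : T.formSesq + (1 : ℝ) • T.innerSesq ∈ T.formSpace :=
  T.formSpace.add_mem T.formSesq_mem_formSpace
    (T.formSpace.smul_mem _ T.innerSesq_mem_formSpace)

theorem re_formSesq_add_innerSesq_self (ψ : T.formDomain) :
    ((T.formSesq + (1 : ℝ) • T.innerSesq) ψ ψ).re = T.normSqT ψ := by
  rw [← add_zero T.formSesq, re_formSesq_add_smul_innerSesq_self, LinearMap.zero_apply,
    LinearMap.zero_apply, Complex.zero_re, normSqT_eq]
  ring

theorem XPlus_subset_XPlus_oneAdd : T.XPlus ⊆ T.oneAdd.XPlus :=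
  T.hasForm_oneAdd.XPlus_subset T.formSesq_add_innerSesq_mem_formSpace

theorem hasSum_normSqT (hγ : γ ∈ T.XPlus) :
    HasSum (fun i => T.normSqT (T.formVec hγ i)) (T.oneAdd.traceMul γ).toReal :=
  (T.hasForm_oneAdd.hasSum_traceMul T.formSesq_add_innerSesq_mem_formSpace hγ).congr_fun fun _ =>
    (T.re_formSesq_add_innerSesq_self _).symm

theorem XPlus_oneAdd : T.oneAdd.XPlus = T.XPlus := by
  refine Set.Subset.antisymm (fun γ hγ => ?_) T.XPlus_subset_XPlus_oneAdd
  have hQ := T.hasForm_oneAdd.1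
  have hmem (i : onbSet H) : sqrtVec γ i ∈ T.formDomain :=
    hQ.le (T.oneAdd.sqrtVec_mem_formDomain hγ i)
  refine T.mem_XPlus_of_summable hγ.1 hmem (Summable.of_nonneg_of_le (fun _ => sq_nonneg _)
    (fun i => ?_) (T.oneAdd.hasSum_traceMul hγ).summable)
  refine le_trans ?_ (T.hasForm_oneAdd.norm_sqrtForm_sq ⟨_, hmem i⟩).ge
  rw [re_formSesq_add_innerSesq_self, normSqT_eq]
  exact le_add_of_nonneg_left (sq_nonneg _)

theorem traceMul_oneAdd_rankOne (ψ : T.formDomain) :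
    (T.oneAdd.traceMul (rankOne ℂ (ψ : H) (ψ : H))).toReal = T.normSqT ψ :=
  (T.hasForm_oneAdd.traceMul_rankOne ψ).trans (T.re_formSesq_add_innerSesq_self ψ)

theorem extNormX_le (ha : a ∈ positiveTraceClass H) (hb : b ∈ positiveTraceClass H) :
    T.extNormX (a - b) ≤ T.oneAdd.traceMul a + T.oneAdd.traceMul b :=
  iInf₂_le_of_le a ha (iInf₂_le_of_le b hb (iInf_le _ rfl))

theorem normX_le_of_mem_XPlus (hγ : γ ∈ T.XPlus) :
    T.normX ⟨γ, T.mem_X_of_mem_XPlus hγ⟩ ≤ (T.oneAdd.traceMul γ).toReal := by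
  have hzero : T.oneAdd.traceMul (0 : H →L[ℂ] H) = 0 := by
    simp only [traceMul, opTrace, mul_zero, zero_apply, inner_zero_right, tsum_zero,
      Complex.zero_re, ENNReal.ofReal_zero, ciSup_const]
  have hle := T.extNormX_le hγ.1 positiveTraceClass_zero
  rw [sub_zero, hzero, add_zero] at hle
  exact ENNReal.toReal_mono (T.XPlus_subset_XPlus_oneAdd hγ).2.ne hle

theorem normX_rankOneX_le (ψ : T.formDomain) : T.normX (T.rankOneX ψ) ≤ T.normSqT ψ :=
  (T.normX_le_of_mem_XPlus (T.rankOne_mem_XPlus ψ)).trans_eq (T.traceMul_oneAdd_rankOne ψ)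

theorem le_normX (γ : T.X) {r : ℝ}
    (h : ∀ a ∈ T.XPlus, ∀ b ∈ T.XPlus, (γ : H →L[ℂ] H) = a - b →
      r ≤ (T.oneAdd.traceMul a).toReal + (T.oneAdd.traceMul b).toReal) : r ≤ T.normX γ := by
  obtain ⟨a, ha, b, hb, hab⟩ := γ.2
  have hfin : T.extNormX (γ : H →L[ℂ] H) ≠ ⊤ :=
    ne_top_of_le_ne_top (ENNReal.add_ne_top.mpr ⟨(T.XPlus_subset_XPlus_oneAdd ha).2.ne,
      (T.XPlus_subset_XPlus_oneAdd hb).2.ne⟩) (hab ▸ T.extNormX_le ha.1 hb.1)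
  rw [normX, ← ENNReal.ofReal_le_iff_le_toReal hfin]
  refine le_iInf₂ fun c hc => le_iInf₂ fun d hd => le_iInf fun hcd => ?_
  by_cases htop : T.oneAdd.traceMul c + T.oneAdd.traceMul d = ⊤
  · exact htop ▸ le_top
  · obtain ⟨hc', hd'⟩ := ENNReal.add_ne_top.mp htop
    rw [ENNReal.ofReal_le_iff_le_toReal htop, ENNReal.toReal_add hc' hd']
    exact h c (T.XPlus_oneAdd.le ⟨hc, hc'.lt_top⟩) d (T.XPlus_oneAdd.le ⟨hd, hd'.lt_top⟩) hcd

variable {T}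

theorem abs_le_mul_normX {ω : T.X →ₗ[ℝ] ℝ} {K : ℝ} (hK : 0 ≤ K)
    (h : ∀ γ (hγ : γ ∈ T.XPlus),
      |ω ⟨γ, T.mem_X_of_mem_XPlus hγ⟩| ≤ K * (T.oneAdd.traceMul γ).toReal) (γ : T.X) :
    |ω γ| ≤ K * T.normX γ := by
  have hdiff : ∀ a ∈ T.XPlus, ∀ b ∈ T.XPlus, (γ : H →L[ℂ] H) = a - b →
      |ω γ| ≤ K * ((T.oneAdd.traceMul a).toReal + (T.oneAdd.traceMul b).toReal) :=
    fun a ha b hb hab => by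
      rw [T.map_eq_sub ω γ ha hb hab, mul_add]
      exact (abs_sub _ _).trans (add_le_add (h a ha) (h b hb))
  rcases hK.eq_or_lt with rfl | hK
  · obtain ⟨a, ha, b, hb, hab⟩ := γ.2
    simpa only [zero_mul] using hdiff a ha b hb hab
  · rw [← div_le_iff₀' hK]
    exact T.le_normX γ fun a ha b hb hab => (div_le_iff₀' hK).mpr (hdiff a ha b hb hab)

theorem abs_sub_sum_rankOneX_le {ω : T.X →ₗ[ℝ] ℝ} {C : ℝ} (hC : 0 ≤ C)
    (h : ∀ γ, |ω γ| ≤ C * T.normX γ) (hγ : γ ∈ T.XPlus) (s : Finset (onbSet H)) :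
    |ω ⟨γ, T.mem_X_of_mem_XPlus hγ⟩ - ∑ i ∈ s, ω (T.rankOneX (T.formVec hγ i))| ≤
      C * ((T.oneAdd.traceMul γ).toReal - ∑ i ∈ s, T.normSqT (T.formVec hγ i)) := by
  set ρ : T.X := ⟨γ, T.mem_X_of_mem_XPlus hγ⟩ - ∑ i ∈ s, T.rankOneX (T.formVec hγ i) with hρ
  have hρX : (ρ : H →L[ℂ] H) ∈ T.XPlus := by
    rw [hρ, Submodule.coe_sub, Submodule.coe_sum]
    exact T.sub_sum_rankOne_mem_XPlus hγ s
  have htrace : (T.oneAdd.traceMul ρ).toReal =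
      (T.oneAdd.traceMul γ).toReal - ∑ i ∈ s, T.normSqT (T.formVec hγ i) := by
    have hsub := T.XPlus_subset_XPlus_oneAdd
    have hrank (ψ : T.formDomain) : traceMulFunctional hsub (T.rankOneX ψ) = T.normSqT ψ :=
      (traceMulFunctional_apply hsub (T.rankOne_mem_XPlus ψ)).trans (T.traceMul_oneAdd_rankOne ψ)
    rw [← traceMulFunctional_apply hsub hρX, ← traceMulFunctional_apply hsub hγ]
    simp only [Subtype.coe_eta, hρ, map_sub, map_sum, hrank]
  calc _ = |ω ρ| := by rw [hρ, map_sub, map_sum]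
    _ ≤ C * T.normX ρ := h ρ
    _ ≤ _ := htrace ▸ mul_le_mul_of_nonneg_left (T.normX_le_of_mem_XPlus hρX) hC

theorem hasSum_apply_rankOneX {ω : T.X →ₗ[ℝ] ℝ} (hω : ω ∈ T.dualX) (hγ : γ ∈ T.XPlus) :
    HasSum (fun i => ω (T.rankOneX (T.formVec hγ i))) (ω ⟨γ, T.mem_X_of_mem_XPlus hγ⟩) := by
  obtain ⟨C, hC, h⟩ := hω
  have hlim : Tendsto (fun s => C * ((T.oneAdd.traceMul γ).toReal -
      ∑ i ∈ s, T.normSqT (T.formVec hγ i))) atTop (𝓝 0) := by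
    have hsum : Tendsto _ atTop _ := T.hasSum_normSqT hγ
    simpa only [sub_self, mul_zero] using
      (hsum.const_sub (T.oneAdd.traceMul γ).toReal).const_mul C
  refine tendsto_iff_norm_sub_tendsto_zero.mpr (squeeze_zero (fun _ => norm_nonneg _)
    (fun s => ?_) hlim)
  rw [norm_sub_rev]
  exact abs_sub_sum_rankOneX_le hC.le h hγ s

end

end PosOp

theorem abs_le_mul_of_hasSum {ι : Type*} {f g : ι → ℝ} {x y K : ℝ} (hf : HasSum f x)
    (hg : HasSum g y) (h : ∀ i, |f i| ≤ K * g i) : |x| ≤ K * y :=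
  abs_le.mpr ⟨neg_le.mp (hasSum_le (fun i => (neg_le_abs _).trans (h i)) hf.neg (hg.mul_left K)),
    hasSum_le (fun i => (le_abs_self _).trans (h i)) hf (hg.mul_left K)⟩

namespace PosOp

section

variable {H : Type*} [NormedAddCommGroup H] [InnerProductSpace ℂ H] [CompleteSpace H]
variable (T : PosOp H)

/-! ### The form of a functional on `X` -/

theorem rankOne_add_rankOne_mem_X (ψ φ : T.formDomain) :
    rankOne ℂ (φ : H) (ψ : H) + rankOne ℂ (ψ : H) (φ : H) ∈ T.X := by
  have h := T.X.sub_mem (T.X.sub_mem (T.rankOne_mem_X (ψ + φ)) (T.rankOne_mem_X ψ))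
    (T.rankOne_mem_X φ)
  convert h using 1
  simp only [Submodule.coe_add, map_add, add_apply]
  abel

/-- The operator `|φ⟩⟨ψ| + |ψ⟩⟨φ|` as an element of `X`, a real bilinear map in `ψ` and `φ`. -/
noncomputable def crossX : T.formDomain →ₗ[ℝ] T.formDomain →ₗ[ℝ] T.X :=
  LinearMap.mk₂ ℝ (fun ψ φ => ⟨_, T.rankOne_add_rankOne_mem_X ψ φ⟩)
    (fun _ _ _ => Subtype.ext <| by
      simp only [Submodule.coe_add, map_add, add_apply]
      abel)
    (fun _ _ _ => Subtype.ext <| by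
      simp only [← Complex.coe_smul, Submodule.coe_smul, map_smul, map_smulₛₗ, smul_apply,
        Complex.conj_ofReal, smul_add])
    (fun _ _ _ => Subtype.ext <| by
      simp only [Submodule.coe_add, map_add, add_apply]
      abel)
    (fun _ _ _ => Subtype.ext <| by
      simp only [← Complex.coe_smul, Submodule.coe_smul, map_smul, map_smulₛₗ, smul_apply,
        Complex.conj_ofReal, smul_add])

theorem crossX_comm (ψ φ : T.formDomain) : T.crossX ψ φ = T.crossX φ ψ :=
  Subtype.ext (add_comm _ _)

theorem crossX_smul_left (c : ℂ) (ψ φ : T.formDomain) :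
    T.crossX (c • ψ) φ = T.crossX ψ (starRingEnd ℂ c • φ) := by
  apply Subtype.ext
  simp only [crossX, LinearMap.mk₂_apply, Submodule.coe_smul, map_smul, map_smulₛₗ, smul_apply,
    Complex.conj_conj]

theorem crossX_self (ψ : T.formDomain) : T.crossX ψ ψ = (2 : ℝ) • T.rankOneX ψ :=
  (two_smul ℝ (T.rankOneX ψ)).symm

theorem crossX_self_I_smul (ψ : T.formDomain) : T.crossX ψ (Complex.I • ψ) = 0 := by
  have h := T.crossX_smul_left Complex.I ψ ψ
  rw [crossX_comm, Complex.conj_I, neg_smul, map_neg, ← add_eq_zero_iff_eq_neg, ← two_smul ℝ] at h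
  exact (smul_eq_zero.mp h).resolve_left two_ne_zero

variable {T}

/-- The form `v_ω` of a functional `ω` on `X`. Its real part is `ω (|φ⟩⟨ψ| + |ψ⟩⟨φ|) / 2`, which
determines its imaginary part by complex linearity in `φ`. -/
noncomputable def functionalForm (ω : T.X →ₗ[ℝ] ℝ) : T.SesqForm where
  toFun ψ := Module.Dual.extendRCLike ((2⁻¹ : ℝ) • ω.comp (T.crossX ψ))
  map_add' ψ φ := by
    rw [map_add, LinearMap.comp_add, smul_add]
    exact map_add Module.Dual.extendRCLikeₗ _ _
  map_smul' c ψ := by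
    ext φ
    rw [LinearMap.smul_apply, ← map_smul]
    simp only [Module.Dual.extendRCLike_apply, LinearMap.smul_apply, LinearMap.comp_apply,
      crossX_smul_left, smul_comm _ (RCLike.I : ℂ)]

theorem functionalForm_apply (ω : T.X →ₗ[ℝ] ℝ) (ψ φ : T.formDomain) :
    functionalForm ω ψ φ =
      ((2⁻¹ * ω (T.crossX ψ φ) : ℝ) : ℂ) -
        Complex.I * ((2⁻¹ * ω (T.crossX ψ (Complex.I • φ)) : ℝ) : ℂ) := rfl

theorem functionalForm_self (ω : T.X →ₗ[ℝ] ℝ) (ψ : T.formDomain) :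
    functionalForm ω ψ ψ = (ω (T.rankOneX ψ) : ℂ) := by
  rw [functionalForm_apply, crossX_self, crossX_self_I_smul, map_smul, map_zero, smul_eq_mul,
    inv_mul_cancel_left₀ two_ne_zero, mul_zero, Complex.ofReal_zero, mul_zero, sub_zero]

theorem functionalForm_symm (ω : T.X →ₗ[ℝ] ℝ) (ψ φ : T.formDomain) :
    functionalForm ω ψ φ = starRingEnd ℂ (functionalForm ω φ ψ) := by
  have hI : T.crossX φ (Complex.I • ψ) = -T.crossX ψ (Complex.I • φ) := by
    rw [crossX_comm, crossX_smul_left, Complex.conj_I, neg_smul, map_neg]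
  rw [functionalForm_apply, functionalForm_apply, T.crossX_comm φ, hI, map_neg, mul_neg,
    Complex.ofReal_neg, map_sub, map_mul, Complex.conj_I, map_neg, Complex.conj_ofReal,
    Complex.conj_ofReal, neg_mul_neg]

theorem functionalForm_mem_formSpace {ω : T.X →ₗ[ℝ] ℝ} (hω : ω ∈ T.dualX) :
    functionalForm ω ∈ T.formSpace := by
  obtain ⟨C, hC, h⟩ := hω
  refine ⟨functionalForm_symm ω, C, hC, fun ψ => ?_⟩
  rw [functionalForm_self, Complex.norm_real]
  exact (h _).trans (mul_le_mul_of_nonneg_left (T.normX_rankOneX_le ψ) hC.le)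

variable (T)

/-- The map `ω ↦ v_ω` from `X*` to `F(T)`. -/
noncomputable def dualToForm : T.dualX →ₗ[ℝ] T.formSpace where
  toFun ω := ⟨functionalForm ω, functionalForm_mem_formSpace ω.2⟩
  map_add' ω η := Subtype.ext <| sesq_ext_diagonal fun ψ => by
    simp only [Submodule.coe_add, LinearMap.add_apply, functionalForm_self, Complex.ofReal_add]
  map_smul' c ω := Subtype.ext <| sesq_ext_diagonal fun ψ => by
    simp only [Submodule.coe_smul, LinearMap.smul_apply, functionalForm_self, RingHom.id_apply,
      smul_eq_mul, Complex.ofReal_mul, Complex.real_smul]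

theorem dualToForm_self (ω : T.dualX) (ψ : T.formDomain) :
    (T.dualToForm ω : T.SesqForm) ψ ψ = ((ω : T.X →ₗ[ℝ] ℝ) (T.rankOneX ψ) : ℂ) :=
  functionalForm_self _ ψ

variable {T} {γ : H →L[ℂ] H}

theorem hasSum_dualToForm (ω : T.dualX) (hγ : γ ∈ T.XPlus) :
    HasSum (fun i => ((T.dualToForm ω : T.SesqForm) (T.formVec hγ i) (T.formVec hγ i)).re)
      ((ω : T.X →ₗ[ℝ] ℝ) ⟨γ, T.mem_X_of_mem_XPlus hγ⟩) :=
  (hasSum_apply_rankOneX ω.2 hγ).congr_fun fun _ => congrArg Complex.re (T.dualToForm_self ω _)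

theorem dualToForm_injective : Function.Injective T.dualToForm := by
  refine (injective_iff_map_eq_zero _).mpr fun ω hω => Subtype.ext (LinearMap.ext fun γ => ?_)
  have hzero {a : H →L[ℂ] H} (ha : a ∈ T.XPlus) :
      (ω : T.X →ₗ[ℝ] ℝ) ⟨a, T.mem_X_of_mem_XPlus ha⟩ = 0 :=
    (hω ▸ hasSum_dualToForm ω ha).unique hasSum_zero
  obtain ⟨a, ha, b, hb, hab⟩ := γ.2
  rw [T.map_eq_sub _ γ ha hb hab, hzero ha, hzero hb, sub_zero]
  rfl

/-! ### The functional of a form -/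

variable {q v : T.SesqForm} {A : PosOp H}

theorem exists_hasForm_add_smul (hv : v ∈ T.formSpace) :
    ∃ (s : ℝ) (A : PosOp H), A.HasForm (v + s • (T.formSesq + (1 : ℝ) • T.innerSesq)) := by
  obtain ⟨K, -, hK⟩ := hv.2
  refine ⟨K + 1, exists_hasForm (T.formSpace.add_mem hv (T.formSpace.smul_mem _
    T.formSesq_add_innerSesq_mem_formSpace)) one_pos fun ψ => ?_⟩
  have hre : -(K * T.normSqT ψ) ≤ (v ψ ψ).re :=
    (abs_le.mp ((Complex.abs_re_le_norm _).trans (hK ψ))).1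
  rw [LinearMap.add_apply, LinearMap.add_apply, LinearMap.smul_apply, LinearMap.smul_apply,
    Complex.add_re, Complex.smul_re, re_formSesq_add_innerSesq_self, smul_eq_mul]
  linarith

theorem exists_functional_of_form (hv : v ∈ T.formSpace) : ∃ ω : T.X →ₗ[ℝ] ℝ,
    (∀ γ (hγ : γ ∈ T.XPlus), HasSum (fun i => (v (T.formVec hγ i) (T.formVec hγ i)).re)
      (ω ⟨γ, T.mem_X_of_mem_XPlus hγ⟩)) ∧
    ∀ ψ, ω (T.rankOneX ψ) = (v ψ ψ).re := by
  obtain ⟨s, A, hA⟩ := exists_hasForm_add_smul hv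
  have hmem := T.formSpace.add_mem hv
    (T.formSpace.smul_mem s T.formSesq_add_innerSesq_mem_formSpace)
  have hre (ψ : T.formDomain) : (v ψ ψ).re =
      ((v + s • (T.formSesq + (1 : ℝ) • T.innerSesq)) ψ ψ).re - s * T.normSqT ψ := by
    rw [← re_formSesq_add_innerSesq_self, LinearMap.add_apply, LinearMap.add_apply,
      LinearMap.smul_apply, LinearMap.smul_apply, Complex.add_re, Complex.smul_re, smul_eq_mul,
      add_sub_cancel_right]
  have hsub := hA.XPlus_subset hmem
  have hsub' := T.XPlus_subset_XPlus_oneAdd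
  refine ⟨traceMulFunctional hsub - s • traceMulFunctional hsub', fun γ hγ => ?_, fun ψ => ?_⟩
  · simp only [LinearMap.sub_apply, LinearMap.smul_apply, traceMulFunctional_apply _ hγ,
      smul_eq_mul, hre]
    exact (hA.hasSum_traceMul hmem hγ).sub ((T.hasSum_normSqT hγ).mul_left s)
  · have hψ := T.rankOne_mem_XPlus ψ
    rw [hre, ← hA.traceMul_rankOne, ← T.traceMul_oneAdd_rankOne, ← traceMulFunctional_apply hsub hψ,
      ← traceMulFunctional_apply hsub' hψ]
    rfl

theorem dualToForm_surjective : Function.Surjective T.dualToForm := by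
  rintro ⟨v, hv⟩
  obtain ⟨ω, hsum, hrank⟩ := exists_functional_of_form hv
  obtain ⟨hsymm, K, hK, hbound⟩ := id hv
  have hω : ω ∈ T.dualX := ⟨K, hK, abs_le_mul_normX hK.le fun γ hγ =>
    abs_le_mul_of_hasSum (hsum γ hγ) (T.hasSum_normSqT hγ) fun _ =>
      (Complex.abs_re_le_norm _).trans (hbound _)⟩
  refine ⟨⟨ω, hω⟩, Subtype.ext (sesq_ext_diagonal fun ψ => ?_)⟩
  rw [dualToForm_self, hrank]
  exact Complex.conj_eq_iff_re.mp (hsymm ψ ψ).symm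

/-- The isomorphism `Φ : X* → F(T)`. -/
noncomputable def dualEquivForm (T : PosOp H) : T.dualX ≃ₗ[ℝ] T.formSpace :=
  LinearEquiv.ofBijective T.dualToForm ⟨dualToForm_injective, dualToForm_surjective⟩

theorem dualToForm_symm_apply (v : T.formSpace) : T.dualToForm (T.dualEquivForm.symm v) = v :=
  T.dualEquivForm.apply_symm_apply v

/-! ### The isometry -/

theorem abs_apply_le_normDual (ω : T.dualX) (γ : T.X) :
    |(ω : T.X →ₗ[ℝ] ℝ) γ| ≤ T.normDual ω * T.normX γ := by
  obtain ⟨C, hC, h⟩ := ω.2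
  rcases (T.normX_nonneg γ).eq_or_lt with h0 | h0
  · simpa only [← h0, mul_zero] using h γ
  · rw [← div_le_iff₀ h0]
    refine le_ciSup (f := fun δ : T.X => |(ω : T.X →ₗ[ℝ] ℝ) δ| / T.normX δ)
      ⟨C, Set.forall_mem_range.mpr fun δ => ?_⟩ γ
    exact div_le_of_le_mul₀ (T.normX_nonneg δ) hC.le (h δ)

theorem norm_apply_le_normForm (hv : v ∈ T.formSpace) (ψ : T.formDomain) :
    ‖v ψ ψ‖ ≤ T.normForm v * T.normSqT ψ := by
  obtain ⟨-, C, hC, h⟩ := hv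
  rcases (T.normSqT_nonneg ψ).eq_or_lt with h0 | h0
  · simpa only [← h0, mul_zero] using h ψ
  · rw [← div_le_iff₀ h0]
    refine le_ciSup (f := fun φ : T.formDomain => ‖v φ φ‖ / T.normSqT φ)
      ⟨C, Set.forall_mem_range.mpr fun φ => ?_⟩ ψ
    exact div_le_of_le_mul₀ (T.normSqT_nonneg φ) hC.le (h φ)

theorem normForm_dualToForm (ω : T.dualX) :
    T.normForm (T.dualToForm ω : T.SesqForm) = T.normDual (ω : T.X →ₗ[ℝ] ℝ) := by
  have hdual : 0 ≤ T.normDual (ω : T.X →ₗ[ℝ] ℝ) :=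
    Real.iSup_nonneg fun γ => div_nonneg (abs_nonneg _) (T.normX_nonneg γ)
  have hform : 0 ≤ T.normForm (T.dualToForm ω : T.SesqForm) :=
    Real.iSup_nonneg fun ψ => div_nonneg (norm_nonneg _) (T.normSqT_nonneg ψ)
  refine le_antisymm (Real.iSup_le (fun ψ => ?_) hdual) (Real.iSup_le (fun γ => ?_) hform)
  · refine div_le_of_le_mul₀ (T.normSqT_nonneg ψ) hdual ?_
    rw [dualToForm_self, Complex.norm_real]
    exact (abs_apply_le_normDual ω _).trans
      (mul_le_mul_of_nonneg_left (T.normX_rankOneX_le ψ) hdual)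
  · refine div_le_of_le_mul₀ (T.normX_nonneg γ) hform (abs_le_mul_normX hform (fun δ hδ => ?_) γ)
    exact abs_le_mul_of_hasSum (hasSum_dualToForm ω hδ) (T.hasSum_normSqT hδ) fun _ =>
      (Complex.abs_re_le_norm _).trans (norm_apply_le_normForm (T.dualToForm ω).2 _)

/-! ### Form sums -/

theorem exists_hasRelBound (hv : v ∈ T.formSpace) : ∃ c₀ > 0, ∀ c : ℝ, |c| < c₀ →
    ∃ a b : ℝ, a < 1 ∧ T.HasRelBound (c • v) a b := by
  obtain ⟨-, K, hK, h⟩ := hv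
  refine ⟨K⁻¹, inv_pos.mpr hK, fun c hc => ⟨|c| * K, |c| * K, ?_, by positivity, by positivity,
    fun ψ => ?_⟩⟩
  · rwa [← lt_div_iff₀ hK, one_div]
  · rw [LinearMap.smul_apply, LinearMap.smul_apply, norm_smul, Real.norm_eq_abs, re_form_self,
      ← mul_add, mul_assoc, add_comm, ← normSqT_eq]
    exact mul_le_mul_of_nonneg_left (h ψ) (abs_nonneg c)

section

variable {C : H →ₗ.[ℂ] H} {c μ : ℝ}

theorem IsFormSum.XPlus_subset (h : T.IsFormSum v C) (hv : v ∈ T.formSpace) (hC : IsSelfAdjoint C)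
    (hμ : IsLowerBound C μ) : T.XPlus ⊆ (subLowerBound C hC μ hμ).XPlus :=
  (h.hasForm_subLowerBound hC hμ).XPlus_subset (T.formSpace.add_mem
    (T.formSpace.add_mem T.formSesq_mem_formSpace hv)
    (T.formSpace.smul_mem _ T.innerSesq_mem_formSpace))

theorem IsFormSum.hasSum (h : T.IsFormSum v C) (hv : v ∈ T.formSpace) (hC : IsSelfAdjoint C)
    (hμ : IsLowerBound C μ) (hγ : γ ∈ T.XPlus) :
    HasSum (fun i => (v (T.formVec hγ i) (T.formVec hγ i)).re)
      (((subLowerBound C hC μ hμ).traceMul γ).toReal - (T.traceMul γ).toReal +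
        μ * (opTrace γ).re) := by
  have hCμ := (h.hasForm_subLowerBound hC hμ).hasSum_traceMul (T.formSpace.add_mem
    (T.formSpace.add_mem T.formSesq_mem_formSpace hv)
    (T.formSpace.smul_mem _ T.innerSesq_mem_formSpace)) hγ
  refine ((hCμ.sub (T.hasSum_traceMul hγ)).add
    ((hasSum_re_opTrace hγ.1).mul_left μ)).congr_fun fun i => ?_
  rw [re_formSesq_add_smul_innerSesq_self]
  change _ = _ + _ + -μ * ‖sqrtVec γ i‖ ^ 2 - _ + _
  ring

theorem IsFormSum.dualEquivForm_symm_apply (v : T.formSpace) (hc : c ≠ 0)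
    (h : T.IsFormSum ((c • v : T.formSpace) : T.SesqForm) C) (hC : IsSelfAdjoint C)
    (hμ : IsLowerBound C μ) (hγ : γ ∈ T.XPlus) :
    (T.dualEquivForm.symm v : T.X →ₗ[ℝ] ℝ) ⟨γ, T.mem_X_of_mem_XPlus hγ⟩ =
      c⁻¹ * (((subLowerBound C hC μ hμ).traceMul γ).toReal - (T.traceMul γ).toReal +
        μ * (opTrace γ).re) := by
  rw [eq_inv_mul_iff_mul_eq₀ hc]
  have hω := hasSum_dualToForm (c • T.dualEquivForm.symm v) hγ
  rw [map_smul, dualToForm_symm_apply] at hω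
  exact hω.unique (h.hasSum (c • v).2 hC hμ hγ)

end

end

end PosOp

theorem mainTheorem5_general {H : Type*} [NormedAddCommGroup H] [InnerProductSpace ℂ H]
    [CompleteSpace H] (T : PosOp H) :
    ∃ hX : ∀ ψ : T.formDomain, rankOne ℂ (ψ : H) (ψ : H) ∈ T.X,
    ∃ Φ : T.dualX ≃ₗ[ℝ] T.formSpace,
      (∀ ω : T.dualX, T.normForm (Φ ω : T.SesqForm) = T.normDual (ω : T.X →ₗ[ℝ] ℝ)) ∧
      (∀ (ω : T.dualX) (ψ φ : T.formDomain),
        (Φ ω : T.SesqForm) ψ φ =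
          1 / 4 * ∑ k ∈ Finset.range 4, Complex.I ^ k *
            (((ω : T.X →ₗ[ℝ] ℝ) ⟨_, hX (ψ + (-Complex.I) ^ k • φ)⟩ : ℝ) : ℂ)) ∧
      (∀ (ω : T.dualX) (ψ : T.formDomain),
        (Φ ω : T.SesqForm) ψ ψ = (((ω : T.X →ₗ[ℝ] ℝ) ⟨_, hX ψ⟩ : ℝ) : ℂ)) ∧
      (∀ v : T.formSpace,
        (∃ c₀ > 0, ∀ c : ℝ, |c| < c₀ →
          ∃ a b : ℝ, a < 1 ∧ T.HasRelBound ((c • v : T.formSpace) : T.SesqForm) a b) ∧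
        (∀ c : ℝ, c ≠ 0 → ∀ a b : ℝ, a < 1 →
          T.HasRelBound ((c • v : T.formSpace) : T.SesqForm) a b →
          ∃ C : H →ₗ.[ℂ] H,
            T.IsFormSum ((c • v : T.formSpace) : T.SesqForm) C ∧
            (∀ C₁ : H →ₗ.[ℂ] H,
              T.IsFormSum ((c • v : T.formSpace) : T.SesqForm) C₁ → C₁ = C) ∧
            IsLowerBound C (-b) ∧
            ∀ (hC : IsSelfAdjoint C) (μ : ℝ) (hμ : IsLowerBound C μ),
              ∀ γp ∈ T.XPlus, ∀ γm ∈ T.XPlus, ∀ γ : T.X, (γ : H →L[ℂ] H) = γp - γm →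
                (PosOp.subLowerBound C hC μ hμ).traceMul γp < ⊤ ∧
                (PosOp.subLowerBound C hC μ hμ).traceMul γm < ⊤ ∧
                ((Φ.symm v : T.dualX) : T.X →ₗ[ℝ] ℝ) γ =
                  c⁻¹ * ((((PosOp.subLowerBound C hC μ hμ).traceMul γp).toReal -
                      ((PosOp.subLowerBound C hC μ hμ).traceMul γm).toReal) -
                    ((T.traceMul γp).toReal - (T.traceMul γm).toReal) +
                    μ * (opTrace (γ : H →L[ℂ] H)).re))) := by
  refine ⟨T.rankOne_mem_X, T.dualEquivForm, PosOp.normForm_dualToForm, fun ω ψ φ => ?_,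
    T.dualToForm_self, fun v => ⟨PosOp.exists_hasRelBound v.2, fun c hc a b ha hab => ?_⟩⟩
  · rw [sesq_polarization]
    exact congrArg _ (Finset.sum_congr rfl fun k _ => congrArg _ (T.dualToForm_self ω _))
  · obtain ⟨C, hC, hbound⟩ := PosOp.exists_isFormSum (c • v).2 ha hab
    refine ⟨C, hC, fun C₁ hC₁ => hC₁.unique hC, hbound, fun hself μ hμ γp hp γm hm γ hγ => ?_⟩
    have hsub := hC.XPlus_subset (c • v).2 hself hμ
    refine ⟨(hsub hp).2, (hsub hm).2, ?_⟩
    rw [T.map_eq_sub _ γ hp hm hγ, hC.dualEquivForm_symm_apply v hc hself hμ hp,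
      hC.dualEquivForm_symm_apply v hc hself hμ hm, hγ, T.re_opTrace_sub hp hm]
    ring

theorem mainTheorem5 {H : Type*} [NormedAddCommGroup H] [InnerProductSpace ℂ H] [CompleteSpace H]
    [TopologicalSpace.SeparableSpace H] (T : PosOp H) :
    -- the rank-one operators `|ψ⟩⟨ψ|` with `ψ` in the form domain belong to `X`, and there is a
    -- linear bijection `Φ` between `X*` and `F(T)` ...
    ∃ hX : ∀ ψ : T.formDomain, InnerProductSpace.rankOne ℂ (ψ : H) (ψ : H) ∈ T.X,
    ∃ Φ : T.dualX ≃ₗ[ℝ] T.formSpace,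
      -- ... which is an isometry,
      (∀ ω : T.dualX, T.normForm (Φ ω : T.SesqForm) = T.normDual (ω : T.X →ₗ[ℝ] ℝ)) ∧
      -- is given by polarization,
      (∀ (ω : T.dualX) (ψ φ : T.formDomain),
        (Φ ω : T.SesqForm) ψ φ =
          1 / 4 * ∑ k ∈ Finset.range 4, Complex.I ^ k *
            (((ω : T.X →ₗ[ℝ] ℝ) ⟨_, hX (ψ + (-Complex.I) ^ k • φ)⟩ : ℝ) : ℂ)) ∧
      (∀ (ω : T.dualX) (ψ : T.formDomain),
        (Φ ω : T.SesqForm) ψ ψ = (((ω : T.X →ₗ[ℝ] ℝ) ⟨_, hX ψ⟩ : ℝ) : ℂ)) ∧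
      -- and whose inverse is given by form sums: `c v` has relative bound less than one for all
      -- small `c > 0`, and whenever it has, the form sum `C` of `T` and `c v` exists, is unique,
      -- and represents the functional that corresponds to `v`.
      (∀ v : T.formSpace,
        (∃ c₀ > 0, ∀ c : ℝ, 0 < c → c < c₀ →
          ∃ a b : ℝ, a < 1 ∧ T.HasRelBound ((c • v : T.formSpace) : T.SesqForm) a b) ∧
        (∀ c : ℝ, 0 < c → ∀ a b : ℝ, a < 1 →
          T.HasRelBound ((c • v : T.formSpace) : T.SesqForm) a b →
          ∃ C : H →ₗ.[ℂ] H,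
            T.IsFormSum ((c • v : T.formSpace) : T.SesqForm) C ∧
            (∀ C₁ : H →ₗ.[ℂ] H,
              T.IsFormSum ((c • v : T.formSpace) : T.SesqForm) C₁ → C₁ = C) ∧
            IsLowerBound C (-b) ∧
            ∀ (hC : IsSelfAdjoint C) (μ : ℝ) (hμ : IsLowerBound C μ),
              ∀ γp ∈ T.XPlus, ∀ γm ∈ T.XPlus, ∀ γ : T.X, (γ : H →L[ℂ] H) = γp - γm →
                (PosOp.subLowerBound C hC μ hμ).traceMul γp < ⊤ ∧
                (PosOp.subLowerBound C hC μ hμ).traceMul γm < ⊤ ∧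
                ((Φ.symm v : T.dualX) : T.X →ₗ[ℝ] ℝ) γ =
                  c⁻¹ * ((((PosOp.subLowerBound C hC μ hμ).traceMul γp).toReal -
                      ((PosOp.subLowerBound C hC μ hμ).traceMul γm).toReal) -
                    ((T.traceMul γp).toReal - (T.traceMul γm).toReal) +
                    μ * (opTrace (γ : H →L[ℂ] H)).re))) := by
  obtain ⟨hX, Φ, hnorm, hpolar, hdiag, hsum⟩ := mainTheorem5_general T
  exact ⟨hX, Φ, hnorm, hpolar, hdiag, fun v => ⟨(hsum v).1.imp fun c₀ h => ⟨h.1, fun c hc hlt =>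
    h.2 c ((abs_of_pos hc).trans_lt hlt)⟩, fun c hc => (hsum v).2 c hc.ne'⟩⟩
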